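/- Let $\tau>0$, $\sigma>1$, $M_0^{\tau,\sigma}=1$ and $M_p^{\tau,\sigma}=p^{\tau p^{\sigma}}$ for $p\in\mathbb N=\{1,2,\dots\}$. Let $\mathcal E_{\{\tau,\sigma\}}(\mathbb R^d)$ be the set of all $\phi\in C^\infty(\mathbb R^d)$ (complex-valued) such that for every compact $K\subset\mathbb R^d$ there are $h,C>0$ with $|\partial^\alpha\phi(x)|\le C\,h^{|\alpha|^\sigma}M^{\tau,\sigma}_{|\alpha|}$ for all $x\in K$ and $\alpha\in\mathbb N_0^d$, and let $\mathcal D_{\{\tau,\sigma\}}(\mathbb R^d)$ be the set of its compactly supported elements. For $h,k>0$ put $$T_{\tau,\sigma}(h,k)=\sup_{p\in\mathbb N}\ln_+\frac{h^{p^\sigma}k^p}{M_p^{\tau,\sigma}},\qquad \ln_+ t=\max\{0,\ln t\}.$$ For $u\in\mathcal D'(\mathbb R^d)$ and $\phi,g\in C_0^\infty(\mathbb R^d)$, the Fourier transform of $\phi u$ is $\widehat{\phi u}(\xi)=(u,\phi\, e^{-2\pi i\,\cdot\,\xi})$, and the short-time Fourier transform of $u$ with window $g$ is $V_gu(x,\xi)=\big(u,\;e^{-2\pi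 i\,\cdot\,\xi}\,\overline{g(\cdot-x)}\big)$, where $(\cdot,\cdot)$ is the bilinear dual pairing. A conic neighborhood of $\xi_0\ne0$ is a neighborhood of $\xi_0$ in $\mathbb R^d\setminus\{0\}$ that is invariant under multiplication by positive reals. For $\xi_0\neq 0$, we say $(x_0,\xi_0)\notin \mathrm{WF}_{\{\tau,\sigma\}}(u)$ if there are a conic neighborhood $\Gamma$ of $\xi_0$, a compact set $K\subset\mathbb R^d$, a function $\phi\in\mathcal D_{\{\tau,\sigma\}}(\mathbb R^d)$ with $\operatorname{supp}\phi=K$ and $\phi(x_0)\ne0$, and constants $h,C>0$ such that $$|\widehat{\phi u}(\xi)|\le C\,\frac{h^{N^\sigma}N^{\tau N^\sigma}}{|\xi|^N},\qquad N\in\mathbb N,\ \xi\in\Gamma .$$ **Theorem.** Let $u\in\mathcal D'(\mathbb R^d)$, $\tau>0$, $\sigma>1$, $x_0\in\mathbb R^d$ and $\xi_0\in\mathbb R^d\setminus\{0\}$. Then $(x_0,\xi_0)\notin\mathrm{WF}_{\{\tau,\sigma\}}(u)$ if and only if there exist a conic neighborhood $\Gamma_0$ of $\xi_0$, a compact neighborhood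 $K$ of $x_0$, a window $g\in\mathcal D_{\{\tau,\sigma\}}(\mathbb R^d)$ with $\operatorname{supp}g=\{y\in\mathbb R^d: y+x_0\in K\}$ and $g(0)\neq0$, and constants $k>0$ and $C>0$ such that $$|V_gu(x,\xi)|\le C\,e^{-T_{\tau,\sigma}(k,|\xi|)},\qquad x\in K,\ \xi\in\Gamma_0 .$$ -/

import Mathlib

open scoped Topology ContDiff Distributions RealInnerProductSpace ComplexConjugate

noncomputable section

namespace ExtGevrey

/-- The space `ℝ^d` with the Euclidean norm and inner product. -/
abbrev Rd (d : ℕ) : Type := EuclideanSpace ℝ (Fin d)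

/-- Complex-valued test functions on `ℝ^d` (smooth, compactly supported), with the usual
inductive limit topology. -/
abbrev TestFun (d : ℕ) : Type := 𝓓((⊤ : TopologicalSpace.Opens (Rd d)), ℂ)

/-- Distributions on `ℝ^d`: continuous complex-linear forms on the space of test functions. -/
abbrev Distr (d : ℕ) : Type := TestFun d →L[ℂ] ℂ

/-- The defining sequence `M_p = p ^ (τ p^σ)`; for `p = 0` and `σ > 0` its value is `1`. -/
def M (τ σ : ℝ) (p : ℕ) : ℝ := (p : ℝ) ^ (τ * (p : ℝ) ^ σ)

/-- The partial derivative `∂^α f (x)`, `α ∈ ℕ₀^d`: the `|α|`-th derivative of `f` at `x` applied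
to `α 0` copies of the first basis vector, then `α 1` copies of the second one, and so on. -/
def partialDeriv {d : ℕ} (α : Fin d → ℕ) (f : Rd d → ℂ) (x : Rd d) : ℂ :=
  iteratedFDeriv ℝ (∑ i, α i) f x
    (fun l => EuclideanSpace.single (finSigmaFinEquiv.symm l).1 (1 : ℝ))

/-- The extended Gevrey class `𝓔_{τ,σ}(ℝ^d)` of Roumieu type. -/
def E (d : ℕ) (τ σ : ℝ) : Set (Rd d → ℂ) :=
  {φ | ContDiff ℝ ∞ φ ∧ ∀ K : Set (Rd d), IsCompact K → ∃ h > 0, ∃ C > 0,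
    ∀ x ∈ K, ∀ α : Fin d → ℕ,
      ‖partialDeriv α φ x‖ ≤ C * h ^ (((∑ i, α i : ℕ) : ℝ) ^ σ) * M τ σ (∑ i, α i)}

/-- `𝓓_{τ,σ}(ℝ^d)` (Roumieu type): the compactly supported elements of `𝓔_{τ,σ}(ℝ^d)`. -/
def D (d : ℕ) (τ σ : ℝ) : Set (TestFun d) := {φ | (φ : Rd d → ℂ) ∈ E d τ σ}

/-- The test function `t ↦ e^{-2πi t·ξ} φ(t)`. -/
def modulate {d : ℕ} (φ : TestFun d) (ξ : Rd d) : TestFun d where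
  toFun t := Complex.exp (-(2 * Real.pi * Complex.I * (⟪t, ξ⟫ : ℝ))) * φ t
  contDiff' := by
    refine ContDiff.mul (ContDiff.cexp (ContDiff.neg (contDiff_const.mul ?_))) φ.contDiff
    exact Complex.ofRealCLM.contDiff.comp (contDiff_id.inner ℝ contDiff_const)
  hasCompactSupport' := φ.hasCompactSupport.mul_left
  tsupport_subset' := by simp

/-- The test function `t ↦ conj (g (t - x))`. -/
def conjTranslate {d : ℕ} (g : TestFun d) (x : Rd d) : TestFun d where
  toFun t := conj (g (t - x))
  contDiff' := Complex.conjCLE.contDiff.comp (g.contDiff.comp (contDiff_id.sub contDiff_const))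
  hasCompactSupport' :=
    (g.hasCompactSupport.comp_homeomorph (Homeomorph.subRight x)).comp_left (map_zero _)
  tsupport_subset' := by simp

/-- The Fourier transform of the compactly supported distribution `φ u`, which is the function
`ξ ↦ (φ u, e^{-2πi ξ·}) = (u, φ e^{-2πi ξ·})`. -/
def fourierCutoff {d : ℕ} (φ : TestFun d) (u : Distr d) (ξ : Rd d) : ℂ := u (modulate φ ξ)

/-- The short-time Fourier transform `V_g u (x, ξ) = ⟨u, M_ξ T_x g⟩`, i.e. `u` applied to
`t ↦ e^{-2πi t·ξ} conj (g (t - x))`. -/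
def stft {d : ℕ} (g : TestFun d) (u : Distr d) (x ξ : Rd d) : ℂ :=
  u (modulate (conjTranslate g x) ξ)

/-- `Γ` is a conic neighbourhood of `ξ₀` in `ℝ^d ∖ {0}`. -/
def IsConicNhd {d : ℕ} (Γ : Set (Rd d)) (ξ₀ : Rd d) : Prop :=
  Γ ∈ 𝓝 ξ₀ ∧ (0 : Rd d) ∉ Γ ∧ ∀ ξ ∈ Γ, ∀ t : ℝ, 0 < t → t • ξ ∈ Γ

/-- The wave-front set `WF_{τ,σ}(u) ⊆ ℝ^d × (ℝ^d ∖ {0})` of Roumieu type. -/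
def WF {d : ℕ} (τ σ : ℝ) (u : Distr d) : Set (Rd d × Rd d) :=
  {p | p.2 ≠ 0 ∧ ¬ ∃ Γ : Set (Rd d), IsConicNhd Γ p.2 ∧ ∃ K : Set (Rd d), IsCompact K ∧
    ∃ φ ∈ D d τ σ, tsupport φ = K ∧ φ p.1 ≠ 0 ∧ ∃ h > 0, ∃ C > 0,
      ∀ N : ℕ, 1 ≤ N → ∀ ξ ∈ Γ,
        ‖fourierCutoff φ u ξ‖ ≤ C * (h ^ ((N : ℝ) ^ σ) * M τ σ N / ‖ξ‖ ^ N)}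

/-- The two-parameter associated function
`T_{τ,σ}(h, k) = sup_{p ≥ 1} ln₊ (h^{p^σ} k^p / M_p)`. -/
def T (τ σ h k : ℝ) : ℝ :=
  ⨆ p : ℕ+, Real.posLog (h ^ (((p : ℕ) : ℝ) ^ σ) * k ^ (p : ℕ) / M τ σ (p : ℕ))

/-- The supremum defining `T_{τ,σ}(h, k)` is taken over a bounded set. -/
theorem bddAbove_T {τ σ h k : ℝ} (hτ : 0 < τ) (hσ : 1 < σ) (hh : 0 < h) (hk : 0 < k) :
    BddAbove (Set.range fun p : ℕ+ =>
      Real.posLog (h ^ (((p : ℕ) : ℝ) ^ σ) * k ^ (p : ℕ) / M τ σ (p : ℕ))) := by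
  set A : ℝ := |Real.log h| + |Real.log k| with hA
  have hA0 : 0 ≤ A := by positivity
  refine ⟨(Real.exp (A / τ)) ^ σ * A, ?_⟩
  rintro _ ⟨p, rfl⟩
  have hp1 : (1 : ℝ) ≤ ((p : ℕ) : ℝ) := by exact_mod_cast p.pos
  have hp0 : (0 : ℝ) < ((p : ℕ) : ℝ) := by linarith
  have hps : ((p : ℕ) : ℝ) ≤ ((p : ℕ) : ℝ) ^ σ := by
    simpa using Real.rpow_le_rpow_of_exponent_le hp1 hσ.le
  have hB : 0 ≤ (Real.exp (A / τ)) ^ σ * A := by positivity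
  refine max_le hB ?_
  have hM : 0 < M τ σ (p : ℕ) := Real.rpow_pos_of_pos hp0 _
  rw [Real.log_div (by positivity) hM.ne', Real.log_mul (by positivity) (by positivity),
    Real.log_rpow hh, Real.log_pow, M, Real.log_rpow hp0]
  have hlp : 0 ≤ Real.log ((p : ℕ) : ℝ) := Real.log_nonneg hp1
  have h1 : ((p : ℕ) : ℝ) ^ σ * Real.log h ≤ ((p : ℕ) : ℝ) ^ σ * |Real.log h| :=
    mul_le_mul_of_nonneg_left (le_abs_self _) (by positivity)
  have h2 : ((p : ℕ) : ℝ) * Real.log k ≤ ((p : ℕ) : ℝ) ^ σ * |Real.log k| :=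
    (mul_le_mul_of_nonneg_left (le_abs_self _) hp0.le).trans
      (mul_le_mul_of_nonneg_right hps (abs_nonneg _))
  have h3 : ((p : ℕ) : ℝ) ^ σ * Real.log h + ((p : ℕ) : ℝ) * Real.log k -
      τ * ((p : ℕ) : ℝ) ^ σ * Real.log ((p : ℕ) : ℝ) ≤
      ((p : ℕ) : ℝ) ^ σ * (A - τ * Real.log ((p : ℕ) : ℝ)) := by
    rw [hA]; nlinarith
  refine h3.trans ?_
  by_cases hc : A ≤ τ * Real.log ((p : ℕ) : ℝ)
  · exact (mul_nonpos_of_nonneg_of_nonpos (by positivity) (by linarith)).trans hB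
  · push Not at hc
    have hple : ((p : ℕ) : ℝ) ≤ Real.exp (A / τ) := by
      rw [← Real.log_le_iff_le_exp hp0, le_div_iff₀ hτ]; linarith
    have hτl : 0 ≤ τ * Real.log ((p : ℕ) : ℝ) := by positivity
    exact mul_le_mul (Real.rpow_le_rpow hp0.le hple (by linarith)) (by linarith)
      (by linarith) (by positivity)

end ExtGevrey

end

/-! The link between the two sides is that `stft g u x` is the Fourier transform of `u` cut off by
`conj (g (· - x))`, while e^{-T} is, up to the truncation at ln₊, the infimum over N of the Gevrey
bounds k^{-N^σ} M_N / |ξ|^N.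

From the short-time Fourier transform to the wave-front set one only needs x = x₀: the cutoff
`conjTranslate g x₀` is admissible, and e^{-T} lies below each N-th bound (`exp_neg_T_le`).

Conversely, let φ be a cutoff with φ(x₀) ≠ 0 for which φu decays in a cone. The class is closed
under local inversion (`exists_gevreyBound_inv`), so for a window with small support and x near x₀
one can write conj g(· - x) = χ_x φ with χ_x in the class, uniformly in x (`exists_quotient`). Hence
V_g u(x, ξ) is the integral over η of the inverse transform of χ_x at η times the transform of φu at
ξ + η (`apply_modulate_eq_integral`). For |η| ≤ c|ξ| the point ξ + η stays in the cone and φu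
decays; for larger η the transform of χ_x decays and that of φu grows only polynomially
(`exists_norm_apply_modulate_le`). Taking the best N gives e^{-T} (`le_mul_exp_neg_T`). The window
is a compressed copy of φ itself, so no bump function has to be constructed.

Inversion works because σ > 1: in the Leibniz recursion for 1/φ, enlarging h to h e^s gains factors
e^{-s n^{σ-1}}, which beat the binomial sums (`recursive_bound`). -/

noncomputable section

namespace ExtGevrey

/-! ### Inequalities for the weights h^{p^σ} M_p. -/

section Weights

variable {τ σ : ℝ}

theorem natCast_rpow_nonneg (n : ℕ) : 0 ≤ (n : ℝ) ^ σ := by positivity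

theorem natCast_le_rpow (hσ : 1 < σ) (n : ℕ) : (n : ℝ) ≤ (n : ℝ) ^ σ := by
  rcases Nat.eq_zero_or_pos n with rfl | hn
  · simp [Real.zero_rpow (by linarith : σ ≠ 0)]
  · simpa using Real.rpow_le_rpow_of_exponent_le (by exact_mod_cast hn : (1 : ℝ) ≤ n) hσ.le

/-- Geometric factors are absorbed by the extended Gevrey ones. -/
theorem pow_le_rpow_rpow (hσ : 1 < σ) {c : ℝ} (hc : 1 ≤ c) (n : ℕ) :
    c ^ n ≤ c ^ ((n : ℝ) ^ σ) := by
  rw [← Real.rpow_natCast]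
  exact Real.rpow_le_rpow_of_exponent_le hc (natCast_le_rpow hσ n)

theorem M_zero (hσ : 1 < σ) : M τ σ 0 = 1 := by
  simp [M, Real.zero_rpow (by linarith : σ ≠ 0)]

theorem M_pos (hσ : 1 < σ) (n : ℕ) : 0 < M τ σ n := by
  rcases Nat.eq_zero_or_pos n with rfl | hn
  · simp [M_zero hσ]
  · exact Real.rpow_pos_of_pos (by exact_mod_cast hn) _

/-- Both bases are raised to i + j, and t ↦ t^σ is superadditive. Leibniz sums therefore cost only
the binomial total 2^n. -/
theorem M_mul_le (hτ : 0 < τ) (hσ : 1 < σ) (i j : ℕ) : M τ σ i * M τ σ j ≤ M τ σ (i + j) := by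
  rcases Nat.eq_zero_or_pos (i + j) with h | h
  · obtain ⟨rfl, rfl⟩ : i = 0 ∧ j = 0 := by omega
    simp [M_zero hσ]
  · have h1 : (1 : ℝ) ≤ ((i + j : ℕ) : ℝ) := by exact_mod_cast h
    have hi : (i : ℝ) ≤ ((i + j : ℕ) : ℝ) := by push_cast; linarith [Nat.cast_nonneg (α := ℝ) j]
    have hj : (j : ℝ) ≤ ((i + j : ℕ) : ℝ) := by push_cast; linarith [Nat.cast_nonneg (α := ℝ) i]
    calc M τ σ i * M τ σ j
        ≤ ((i + j : ℕ) : ℝ) ^ (τ * (i : ℝ) ^ σ) * ((i + j : ℕ) : ℝ) ^ (τ * (j : ℝ) ^ σ) := by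
          unfold M
          gcongr
      _ = ((i + j : ℕ) : ℝ) ^ (τ * ((i : ℝ) ^ σ + (j : ℝ) ^ σ)) := by
          rw [← Real.rpow_add (by linarith), mul_add]
      _ ≤ M τ σ (i + j) := by
          unfold M
          refine Real.rpow_le_rpow_of_exponent_le h1 (mul_le_mul_of_nonneg_left ?_ hτ.le)
          push_cast
          exact Real.add_rpow_le_rpow_add (by positivity) (by positivity) hσ.le

theorem one_le_M (hτ : 0 < τ) (hσ : 1 < σ) (n : ℕ) : 1 ≤ M τ σ n := by
  rcases Nat.eq_zero_or_pos n with rfl | hn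
  · simp [M_zero hσ]
  · exact Real.one_le_rpow (by exact_mod_cast hn) (by positivity)

theorem M_mono (hτ : 0 < τ) (hσ : 1 < σ) {i n : ℕ} (h : i ≤ n) : M τ σ i ≤ M τ σ n := by
  obtain ⟨j, rfl⟩ := Nat.exists_eq_add_of_le h
  exact (le_mul_of_one_le_right (M_pos hσ i).le (one_le_M hτ hσ j)).trans (M_mul_le hτ hσ i j)

theorem rpow_rpow_mono (hσ : 1 < σ) {h H : ℝ} (hh : 1 ≤ h) (hH : h ≤ H) {i n : ℕ} (hin : i ≤ n) :
    h ^ ((i : ℝ) ^ σ) ≤ H ^ ((n : ℝ) ^ σ) :=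
  (Real.rpow_le_rpow_of_exponent_le hh
    (Real.rpow_le_rpow (by positivity) (by exact_mod_cast hin) (by linarith))).trans
    (Real.rpow_le_rpow (by linarith) hH (natCast_rpow_nonneg n))

theorem rpow_mul_M_mul_le (hτ : 0 < τ) (hσ : 1 < σ) {h : ℝ} (hh : 1 ≤ h) (i j : ℕ) :
    (h ^ ((i : ℝ) ^ σ) * M τ σ i) * (h ^ ((j : ℝ) ^ σ) * M τ σ j) ≤
      h ^ (((i + j : ℕ) : ℝ) ^ σ) * M τ σ (i + j) := by
  have h1 : h ^ ((i : ℝ) ^ σ) * h ^ ((j : ℝ) ^ σ) ≤ h ^ (((i + j : ℕ) : ℝ) ^ σ) := by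
    rw [← Real.rpow_add (by linarith)]
    refine Real.rpow_le_rpow_of_exponent_le hh ?_
    push_cast
    exact Real.add_rpow_le_rpow_add (by positivity) (by positivity) hσ.le
  calc _ = (h ^ ((i : ℝ) ^ σ) * h ^ ((j : ℝ) ^ σ)) * (M τ σ i * M τ σ j) := by ring
    _ ≤ _ := mul_le_mul h1 (M_mul_le hτ hσ i j)
      (mul_nonneg (M_pos hσ i).le (M_pos hσ j).le) (by positivity)

theorem succ_rpow_le (hσ : 1 < σ) {n : ℕ} (hn : 1 ≤ n) :
    ((n + 1 : ℕ) : ℝ) ^ σ ≤ 2 ^ σ * (n : ℝ) ^ σ := by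
  have h1 : (1 : ℝ) ≤ n := by exact_mod_cast hn
  rw [← Real.mul_rpow (by norm_num) (by positivity)]
  exact Real.rpow_le_rpow (by positivity) (by push_cast; linarith) (by linarith)

/-- The sequence `M_p` is stable under differentiation, up to a factor `A ^ (p^σ)`. -/
theorem M_succ_le (hτ : 0 < τ) (hσ : 1 < σ) :
    ∃ A : ℝ, 1 ≤ A ∧ ∀ n : ℕ, M τ σ (n + 1) ≤ A ^ ((n : ℝ) ^ σ) * M τ σ n := by
  refine ⟨Real.exp (τ * (σ * 2 ^ σ + 1)), Real.one_le_exp (by positivity), fun n => ?_⟩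
  rcases Nat.eq_zero_or_pos n with rfl | hn
  · simp [M, Real.zero_rpow (by linarith : σ ≠ 0)]
  have h1 : (1 : ℝ) ≤ n := by exact_mod_cast hn
  have h0 : (0 : ℝ) < n := by linarith
  have hm : (0 : ℝ) < ((n + 1 : ℕ) : ℝ) := by positivity
  set m : ℝ := ((n + 1 : ℕ) : ℝ) with hmdef
  have hmn : m = n + 1 := by simp [hmdef]
  -- Bernoulli's inequality serves as a mean value bound m^σ - n^σ ≤ σ m^{σ-1}. The increment of t^σ
  -- log t is then split into (m^σ - n^σ) log m and n^σ (log m - log n), both O(n^σ).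
  have bern : m ^ σ * (1 - σ / m) ≤ (n : ℝ) ^ σ := by
    have h := one_add_mul_self_le_rpow_one_add (s := -1 / m)
      (by rw [le_div_iff₀ hm]; linarith) hσ.le
    have h2 : (n : ℝ) = m * (1 + -1 / m) := by field_simp; linarith
    rw [h2, Real.mul_rpow hm.le (by rw [show 1 + -1 / m = n / m by field_simp; linarith]; positivity)]
    refine mul_le_mul_of_nonneg_left ?_ (by positivity)
    calc 1 - σ / m = 1 + σ * (-1 / m) := by ring
      _ ≤ _ := h
  have hlog : Real.log m ≤ m := (Real.log_le_sub_one_of_pos hm).trans (by linarith)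
  have hlog0 : 0 ≤ Real.log m := Real.log_nonneg (by linarith)
  have hlog2 : Real.log m - Real.log n ≤ 1 / n := by
    rw [← Real.log_div hm.ne' h0.ne']
    refine (Real.log_le_sub_one_of_pos (by positivity)).trans (le_of_eq ?_)
    rw [hmn]; field_simp; ring
  have key : m ^ σ * Real.log m - (n : ℝ) ^ σ * Real.log n ≤ (σ * 2 ^ σ + 1) * (n : ℝ) ^ σ := by
    have e1 : (m ^ σ - (n : ℝ) ^ σ) * Real.log m ≤ σ * m ^ σ := by
      have : m ^ σ - (n : ℝ) ^ σ ≤ σ * m ^ σ / m := by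
        have : m ^ σ * (1 - σ / m) = m ^ σ - σ * m ^ σ / m := by ring
        linarith
      calc _ ≤ σ * m ^ σ / m * m := mul_le_mul this hlog hlog0 (by positivity)
        _ = _ := by field_simp
    have e2 : (n : ℝ) ^ σ * (Real.log m - Real.log n) ≤ (n : ℝ) ^ σ := by
      refine mul_le_of_le_one_right (by positivity) (hlog2.trans ?_)
      rw [div_le_one h0]; exact h1
    have e3 : σ * m ^ σ ≤ σ * (2 ^ σ * (n : ℝ) ^ σ) :=
      mul_le_mul_of_nonneg_left (succ_rpow_le hσ hn) (by linarith)
    linarith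
  have e1 : M τ σ (n + 1) = Real.exp (Real.log m * (τ * m ^ σ)) := Real.rpow_def_of_pos hm _
  have e2 : M τ σ n = Real.exp (Real.log n * (τ * (n : ℝ) ^ σ)) := Real.rpow_def_of_pos h0 _
  rw [e1, e2, ← Real.exp_mul, ← Real.exp_add]
  refine Real.exp_le_exp.2 ?_
  have := mul_le_mul_of_nonneg_left key hτ.le
  linarith

theorem rpow_mul_M_shift_le (hτ : 0 < τ) (hσ : 1 < σ) {H : ℝ} (hH : 1 ≤ H) (L : ℕ) :
    ∃ C H' : ℝ, 1 ≤ C ∧ 1 ≤ H' ∧ ∀ n : ℕ,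
      H ^ (((n + L : ℕ) : ℝ) ^ σ) * M τ σ (n + L) ≤ C * H' ^ ((n : ℝ) ^ σ) * M τ σ n := by
  induction L with
  | zero => exact ⟨1, H, le_rfl, hH, fun n => by simp⟩
  | succ L ih =>
    obtain ⟨C, H', hC, hH', ih⟩ := ih
    obtain ⟨A, hA, hM⟩ := M_succ_le (τ := τ) hτ hσ
    have h2 : (1 : ℝ) ≤ H' ^ (2 ^ σ : ℝ) := Real.one_le_rpow hH' (by positivity)
    refine ⟨C * H', H' ^ (2 ^ σ : ℝ) * A, one_le_mul_of_one_le_of_one_le hC hH',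
      one_le_mul_of_one_le_of_one_le h2 hA, fun n => ?_⟩
    -- The extra factor `H'` is there for n = 0, where 0^σ = 0 and no power of a larger base can
    -- absorb the shift.
    have h3 : H' ^ (((n + 1 : ℕ) : ℝ) ^ σ) ≤ H' * (H' ^ (2 ^ σ : ℝ)) ^ ((n : ℝ) ^ σ) := by
      rcases Nat.eq_zero_or_pos n with rfl | hn
      · simp [Real.zero_rpow (by linarith : σ ≠ 0)]
      · rw [← Real.rpow_mul (by linarith)]
        exact (Real.rpow_le_rpow_of_exponent_le hH' (succ_rpow_le hσ hn)).trans
          (le_mul_of_one_le_left (by positivity) hH')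
    have hb := ih (n + 1)
    rw [show n + (L + 1) = n + 1 + L by ring]
    refine hb.trans ?_
    rw [Real.mul_rpow (by positivity) (by positivity)]
    calc C * H' ^ (((n + 1 : ℕ) : ℝ) ^ σ) * M τ σ (n + 1)
        ≤ C * (H' * (H' ^ (2 ^ σ : ℝ)) ^ ((n : ℝ) ^ σ)) * (A ^ ((n : ℝ) ^ σ) * M τ σ n) := by
          refine mul_le_mul (mul_le_mul_of_nonneg_left h3 (by linarith)) (hM n) (M_pos hσ _).le ?_
          positivity
      _ = _ := by ring

/-- A number `s` for which `n e^{-s n^{σ-1}}` is uniformly small. -/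
theorem exists_mul_exp_neg_le (hσ : 1 < σ) {δ : ℝ} (hδ : 0 < δ) :
    ∃ s : ℝ, 0 ≤ s ∧ ∀ n : ℕ, 1 ≤ n → (n : ℝ) * Real.exp (-s * (n : ℝ) ^ (σ - 1)) ≤ δ := by
  have hσ' : 0 < σ - 1 := by linarith
  refine ⟨1 / (σ - 1) + |Real.log δ|, by positivity, fun n hn => ?_⟩
  have h1 : (1 : ℝ) ≤ n := by exact_mod_cast hn
  have h0 : (0 : ℝ) < n := by linarith
  set y : ℝ := (n : ℝ) ^ (σ - 1) with hy
  have hy1 : 1 ≤ y := Real.one_le_rpow h1 hσ'.le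
  have hl : Real.log n ≤ 1 / (σ - 1) * y := by
    have := Real.log_le_rpow_div h0.le hσ'
    rw [one_div_mul_eq_div]; exact this
  have h2 : (n : ℝ) = Real.exp (Real.log n) := (Real.exp_log h0).symm
  have h3 : |Real.log δ| ≤ |Real.log δ| * y := le_mul_of_one_le_right (abs_nonneg _) hy1
  calc (n : ℝ) * Real.exp (-(1 / (σ - 1) + |Real.log δ|) * y)
      = Real.exp (Real.log n + -(1 / (σ - 1) + |Real.log δ|) * y) := by
        rw [Real.exp_add, ← h2]
    _ ≤ Real.exp (Real.log δ) := by
        refine Real.exp_le_exp.2 ?_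
        linarith [neg_abs_le (Real.log δ)]
    _ = δ := Real.exp_log hδ

/-- If `a` satisfies the recursive inequality coming from the Leibniz rule for `f = 1 + κ f` with
`‖κ‖ ≤ 1 / 2`, then extended Gevrey bounds pass from (the derivatives of) `κ` to `f`. -/
theorem recursive_bound (hτ : 0 < τ) (hσ : 1 < σ) {h B : ℝ} (hh : 1 ≤ h) (hB : 0 < B) :
    ∃ H : ℝ, 1 ≤ H ∧ ∀ (a b : ℕ → ℝ) (A : ℝ), (∀ n, 0 ≤ a n) → a 0 ≤ A →
      (∀ n, b n ≤ B * h ^ ((n : ℝ) ^ σ) * M τ σ n) →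
      (∀ n, 1 ≤ n → a n ≤ 1 / 2 * a n +
        ∑ j ∈ Finset.range n, (n.choose (j + 1) : ℝ) * b (j + 1) * a (n - (j + 1))) →
      ∀ n, a n ≤ A * H ^ ((n : ℝ) ^ σ) * M τ σ n := by
  -- This δ satisfies e^δ - 1 = 1/(2B), so that the sum over j will be at most half of the claimed
  -- bound; the term a_n / 2 supplies the other half.
  have hδ : 0 < Real.log (1 + 1 / (2 * B)) := Real.log_pos (by simp; positivity)
  obtain ⟨s, hs0, hs⟩ := exists_mul_exp_neg_le hσ hδ
  have hes : 1 ≤ Real.exp s := Real.one_le_exp hs0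
  have hH1 : 1 ≤ h * Real.exp s := one_le_mul_of_one_le_of_one_le hh hes
  refine ⟨h * Real.exp s, hH1, fun a b A ha ha0 hb hrec n => ?_⟩
  set H := h * Real.exp s with hH
  have hA : 0 ≤ A := (ha 0).trans ha0
  induction n using Nat.strong_induction_on with
  | _ n ih =>
  rcases Nat.eq_zero_or_pos n with rfl | hn
  · simpa [M_zero hσ, Real.zero_rpow (by linarith : σ ≠ 0)] using ha0
  have h1 : (1 : ℝ) ≤ n := by exact_mod_cast hn
  have h0 : (0 : ℝ) < n := by linarith
  set y : ℝ := (n : ℝ) ^ (σ - 1) with hy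
  have hny : (n : ℝ) ^ σ = n * y := by
    rw [hy, Real.rpow_sub_one h0.ne']; field_simp
  -- For i ≤ n one has i^σ ≤ i y, which makes the weights geometric with ratios h^y = H^y r and H^y.
  -- The j-th term gains r^j, and ∑_{j ≥ 1} C(n,j) r^j = (1 + r)^n - 1 ≤ e^{nr} - 1.
  set r : ℝ := Real.exp (-s * y) with hr
  have hrpow : (h : ℝ) ^ y = H ^ y * r := by
    rw [hH, Real.mul_rpow (by linarith) (by positivity), ← Real.exp_mul, mul_assoc,
      ← Real.exp_add]
    simp
  have hle : ∀ i : ℕ, i ≤ n → ∀ c : ℝ, 1 ≤ c → c ^ ((i : ℝ) ^ σ) ≤ (c ^ y) ^ i := by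
    intro i hi c hc
    rw [← Real.rpow_mul_natCast (by linarith)]
    refine Real.rpow_le_rpow_of_exponent_le hc ?_
    rcases Nat.eq_zero_or_pos i with rfl | hi0
    · simp [Real.zero_rpow (by linarith : σ ≠ 0)]
    · have h0' : (0 : ℝ) < i := by exact_mod_cast hi0
      have : (i : ℝ) ^ σ = (i : ℝ) ^ (σ - 1) * i := by
        rw [Real.rpow_sub_one h0'.ne']; field_simp
      rw [this]
      refine mul_le_mul_of_nonneg_right ?_ h0'.le
      exact Real.rpow_le_rpow h0'.le (by exact_mod_cast hi) (by linarith)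
  have hterm : ∀ j ∈ Finset.range n, (n.choose (j + 1) : ℝ) * b (j + 1) * a (n - (j + 1)) ≤
      (A * B * H ^ ((n : ℝ) ^ σ) * M τ σ n) * (r ^ (j + 1) * (n.choose (j + 1) : ℝ)) := by
    intro j hj
    have hjn : j + 1 ≤ n := Finset.mem_range.1 hj
    have hy0 : 0 ≤ H ^ y := by positivity
    have e1 : b (j + 1) ≤ B * (H ^ y * r) ^ (j + 1) * M τ σ (j + 1) := by
      refine (hb _).trans ?_
      rw [← hrpow]
      exact mul_le_mul_of_nonneg_right (mul_le_mul_of_nonneg_left (hle _ hjn h hh) hB.le)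
        (M_pos hσ _).le
    have e2 : a (n - (j + 1)) ≤ A * (H ^ y) ^ (n - (j + 1)) * M τ σ (n - (j + 1)) := by
      refine (ih _ (by omega)).trans ?_
      exact mul_le_mul_of_nonneg_right (mul_le_mul_of_nonneg_left (hle _ (by omega) H hH1) hA)
        (M_pos hσ _).le
    have e3 : M τ σ (j + 1) * M τ σ (n - (j + 1)) ≤ M τ σ n := by
      have := M_mul_le (τ := τ) hτ hσ (j + 1) (n - (j + 1))
      rwa [Nat.add_sub_cancel' hjn] at this
    have e4 : H ^ ((n : ℝ) ^ σ) = (H ^ y) ^ (j + 1) * (H ^ y) ^ (n - (j + 1)) := by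
      rw [← pow_add, Nat.add_sub_cancel' hjn, hny, mul_comm, Real.rpow_mul_natCast (by linarith)]
    have e5 : b (j + 1) * a (n - (j + 1)) ≤ (B * (H ^ y * r) ^ (j + 1) * M τ σ (j + 1)) *
        (A * (H ^ y) ^ (n - (j + 1)) * M τ σ (n - (j + 1))) :=
      mul_le_mul e1 e2 (ha _) (by have := M_pos (τ := τ) hσ (j + 1); positivity)
    calc (n.choose (j + 1) : ℝ) * b (j + 1) * a (n - (j + 1))
        = (n.choose (j + 1) : ℝ) * (b (j + 1) * a (n - (j + 1))) := by ring
      _ ≤ (n.choose (j + 1) : ℝ) * ((B * (H ^ y * r) ^ (j + 1) * M τ σ (j + 1)) *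
        (A * (H ^ y) ^ (n - (j + 1)) * M τ σ (n - (j + 1)))) :=
          mul_le_mul_of_nonneg_left e5 (by positivity)
      _ = (n.choose (j + 1) : ℝ) * (A * B * H ^ ((n : ℝ) ^ σ) * r ^ (j + 1)) *
          (M τ σ (j + 1) * M τ σ (n - (j + 1))) := by rw [e4, mul_pow]; ring
      _ ≤ (n.choose (j + 1) : ℝ) * (A * B * H ^ ((n : ℝ) ^ σ) * r ^ (j + 1)) * M τ σ n :=
          mul_le_mul_of_nonneg_left e3 (by positivity)
      _ = _ := by ring
  have hbin : ∑ j ∈ Finset.range n, r ^ (j + 1) * (n.choose (j + 1) : ℝ) ≤ 1 / (2 * B) := by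
    have e1 : (r + 1) ^ n =
        ∑ j ∈ Finset.range n, r ^ (j + 1) * (n.choose (j + 1) : ℝ) + 1 := by
      rw [add_pow, Finset.sum_range_succ']
      simp
    have e2 : (r + 1) ^ n ≤ 1 + 1 / (2 * B) := by
      calc (r + 1) ^ n ≤ Real.exp r ^ n :=
            pow_le_pow_left₀ (by positivity) (Real.add_one_le_exp r) n
        _ = Real.exp (n * r) := by rw [← Real.exp_nat_mul]
        _ ≤ Real.exp (Real.log (1 + 1 / (2 * B))) := Real.exp_le_exp.2 (hs n hn)
        _ = _ := Real.exp_log (by positivity)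
    linarith
  have hsum := (hrec n hn).trans (add_le_add_right (Finset.sum_le_sum hterm) _)
  rw [← Finset.mul_sum] at hsum
  have hMn := M_pos (τ := τ) hσ n
  have := mul_le_mul_of_nonneg_left hbin
    (by positivity : 0 ≤ A * B * H ^ ((n : ℝ) ^ σ) * M τ σ n)
  have e : A * B * H ^ ((n : ℝ) ^ σ) * M τ σ n * (1 / (2 * B)) =
      1 / 2 * (A * H ^ ((n : ℝ) ^ σ) * M τ σ n) := by field_simp
  linarith

end Weights

/-! ### From partial derivatives to norms of full derivatives; stability of the class. -/

section GevreyBounds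

variable {d : ℕ} {τ σ : ℝ}

/-- Expanding every argument in the basis gives d^n terms, each with coordinates bounded by the
norms. The loss d^n is later absorbed into h^{n^σ}. -/
theorem norm_multilinear_le_of_basis {n : ℕ}
    (A : ContinuousMultilinearMap ℝ (fun _ : Fin n => Rd d) ℂ) {B : ℝ}
    (hA : ∀ l : Fin n → Fin d, ‖A fun i => EuclideanSpace.single (l i) (1 : ℝ)‖ ≤ B) (hB : 0 ≤ B) :
    ‖A‖ ≤ (d : ℝ) ^ n * B := by
  refine A.opNorm_le_bound (by positivity) fun m => ?_
  have hm : m = fun i => ∑ j : Fin d, m i j • EuclideanSpace.single j (1 : ℝ) := by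
    funext i
    have := (EuclideanSpace.basisFun (Fin d) ℝ).sum_repr (m i)
    simpa using this.symm
  rw [hm, A.map_sum]
  refine (norm_sum_le _ _).trans ?_
  have : ∀ r ∈ (Finset.univ : Finset (Fin n → Fin d)),
      ‖A fun i => m i (r i) • EuclideanSpace.single (r i) (1 : ℝ)‖ ≤ B * ∏ i, ‖m i‖ := by
    intro r _
    rw [A.map_smul_univ, norm_smul, norm_prod, mul_comm]
    refine mul_le_mul (hA r) ?_ (by positivity) hB
    exact Finset.prod_le_prod (fun _ _ => norm_nonneg _) fun i _ => PiLp.norm_apply_le (m i) (r i)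
  refine (Finset.sum_le_sum this).trans (le_of_eq ?_)
  rw [← hm]
  simp [mul_assoc]

/-- Iterated directional derivatives along a list of directions. -/
def listDeriv (f : Rd d → ℂ) : List (Rd d) → Rd d → ℂ
  | [] => f
  | v :: l => fun x => fderiv ℝ (listDeriv f l) x v

theorem contDiff_listDeriv {f : Rd d → ℂ} (hf : ContDiff ℝ ∞ f) (l : List (Rd d)) :
    ContDiff ℝ ∞ (listDeriv f l) := by
  induction l with
  | nil => exact hf
  | cons v l ih => exact (ih.fderiv_right (m := ∞) (by simp)).clm_apply contDiff_const

/-- Permutations of a list are generated by swaps of its two leading entries under further cons, so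
symmetry of the second derivative suffices. -/
theorem listDeriv_perm {f : Rd d → ℂ} (hf : ContDiff ℝ ∞ f) {l l' : List (Rd d)}
    (h : l.Perm l') : listDeriv f l = listDeriv f l' := by
  induction h with
  | nil => rfl
  | cons v _ ih => simp only [listDeriv, ih]
  | swap v w l =>
    funext x
    have hl := contDiff_listDeriv hf l
    have hd : DifferentiableAt ℝ (fderiv ℝ (listDeriv f l)) x :=
      ((hl.fderiv_right (m := ∞) (by simp)).differentiable (by simp)) x
    have hsymm := (hl.contDiffAt (x := x)).isSymmSndFDerivAt
      (by simpa using WithTop.coe_le_coe.2 (le_top : (2 : ℕ∞) ≤ ⊤))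
    simp only [listDeriv]
    rw [fderiv_clm_apply hd (by fun_prop), fderiv_clm_apply hd (by fun_prop)]
    simpa using hsymm w v
  | trans _ _ ih1 ih2 => exact ih1.trans ih2

theorem iteratedFDeriv_eq_listDeriv {f : Rd d → ℂ} (hf : ContDiff ℝ ∞ f) (n : ℕ)
    (m : Fin n → Rd d) : (fun x => iteratedFDeriv ℝ n f x m) = listDeriv f (List.ofFn m) := by
  induction n with
  | zero => funext x; simp [listDeriv]
  | succ n ih =>
    funext x
    have hd : DifferentiableAt ℝ (iteratedFDeriv ℝ n f) x :=
      (hf.differentiable_iteratedFDeriv (by exact_mod_cast WithTop.coe_lt_top _)) x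
    rw [iteratedFDeriv_succ_apply_left, List.ofFn_succ, listDeriv, ← ih (fun i => m i.succ)]
    exact (fderiv_continuousMultilinear_apply_const_apply hd (Fin.tail m) (m 0)).symm

theorem iteratedFDeriv_comp_perm {f : Rd d → ℂ} (hf : ContDiff ℝ ∞ f) (x : Rd d) {n : ℕ}
    (m : Fin n → Rd d) (s : Equiv.Perm (Fin n)) :
    iteratedFDeriv ℝ n f x (m ∘ s) = iteratedFDeriv ℝ n f x m := by
  have h := listDeriv_perm hf (Equiv.Perm.ofFn_comp_perm s m)
  rw [← iteratedFDeriv_eq_listDeriv hf, ← iteratedFDeriv_eq_listDeriv hf] at h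
  exact congrFun h x

/-- Mixed partial derivatives in any order agree with the sorted ones. -/
theorem iteratedFDeriv_basis_eq_partialDeriv {f : Rd d → ℂ} (hf : ContDiff ℝ ∞ f) (x : Rd d) {n : ℕ}
    (l : Fin n → Fin d) : ∃ α : Fin d → ℕ, ∑ i, α i = n ∧
      iteratedFDeriv ℝ n f x (fun i => EuclideanSpace.single (l i) (1 : ℝ)) =
        partialDeriv α f x := by
  classical
  let α : Fin d → ℕ := fun j => Fintype.card {i // l i = j}
  have hα : ∑ i, α i = n := by
    have := Fintype.card_congr (Equiv.sigmaFiberEquiv l)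
    simpa [Fintype.card_sigma] using this
  refine ⟨α, hα, ?_⟩
  let e : (Σ j, Fin (α j)) ≃ Fin n :=
    (Equiv.sigmaCongrRight fun j => (Fintype.equivFin {i // l i = j}).symm).trans
      (Equiv.sigmaFiberEquiv l)
  have he : ∀ p, l (e p) = p.1 := fun p => ((Fintype.equivFin {i // l i = p.1}).symm p.2).2
  -- The order ∑ α equals n only propositionally, so the order is generalised before substitution.
  have key : ∀ (N : ℕ) (hN : N = n) (s : (Σ j, Fin (α j)) ≃ Fin N),
      iteratedFDeriv ℝ n f x (fun i => EuclideanSpace.single (l i) (1 : ℝ)) =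
        iteratedFDeriv ℝ N f x (fun i => EuclideanSpace.single (s.symm i).1 (1 : ℝ)) := by
    rintro N rfl s
    have := iteratedFDeriv_comp_perm hf x (fun i => EuclideanSpace.single (l i) (1 : ℝ))
      (s.symm.trans e)
    rw [← this]
    congr 1
    funext i
    simp [he]
  exact key _ hα finSigmaFinEquiv

/-- Extended Gevrey bounds on a set, in terms of the norms of the full derivatives. -/
def GevreyBound (τ σ : ℝ) (f : Rd d → ℂ) (s : Set (Rd d)) : Prop :=
  ∃ C h : ℝ, 1 ≤ C ∧ 1 ≤ h ∧ ∀ x ∈ s, ∀ n : ℕ,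
    ‖iteratedFDeriv ℝ n f x‖ ≤ C * h ^ ((n : ℝ) ^ σ) * M τ σ n

/-- The class bounds only sorted partial derivatives; by symmetry these are all the values on basis
vectors. -/
theorem gevreyBound_of_mem_E (hσ : 1 < σ) {f : Rd d → ℂ} (hf : f ∈ E d τ σ)
    {K : Set (Rd d)} (hK : IsCompact K) : GevreyBound τ σ f K := by
  obtain ⟨hs, hb⟩ := hf
  obtain ⟨h, hh, C, hC, hb⟩ := hb K hK
  have hh1 : 1 ≤ max h 1 := le_max_right _ _
  have hd : (1 : ℝ) ≤ max (d : ℝ) 1 := le_max_right _ _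
  refine ⟨max C 1, max (d : ℝ) 1 * max h 1, le_max_right _ _,
    one_le_mul_of_one_le_of_one_le hd hh1, fun x hx n => ?_⟩
  have hMn := M_pos (τ := τ) hσ n
  have h1 : ‖iteratedFDeriv ℝ n f x‖ ≤
      (d : ℝ) ^ n * (C * h ^ ((n : ℝ) ^ σ) * M τ σ n) := by
    refine norm_multilinear_le_of_basis _ (fun l => ?_) (by positivity)
    obtain ⟨α, rfl, h2⟩ := iteratedFDeriv_basis_eq_partialDeriv hs x l
    rw [h2]
    exact hb x hx α
  have h2 : (d : ℝ) ^ n ≤ max (d : ℝ) 1 ^ ((n : ℝ) ^ σ) :=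
    (pow_le_pow_left₀ (by positivity) (le_max_left _ _) n).trans (pow_le_rpow_rpow hσ hd n)
  have h3 : h ^ ((n : ℝ) ^ σ) ≤ max h 1 ^ ((n : ℝ) ^ σ) :=
    Real.rpow_le_rpow hh.le (le_max_left _ _) (natCast_rpow_nonneg n)
  refine h1.trans ?_
  rw [Real.mul_rpow (by linarith) (by linarith)]
  calc (d : ℝ) ^ n * (C * h ^ ((n : ℝ) ^ σ) * M τ σ n)
      ≤ max (d : ℝ) 1 ^ ((n : ℝ) ^ σ) *
        (max C 1 * max h 1 ^ ((n : ℝ) ^ σ) * M τ σ n) := by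
        gcongr
        exact le_max_left _ _
    _ = _ := by ring

theorem mem_E_of_gevreyBound {f : Rd d → ℂ} (hs : ContDiff ℝ ∞ f)
    (hf : GevreyBound τ σ f Set.univ) : f ∈ E d τ σ := by
  obtain ⟨C, h, hC, hh, hb⟩ := hf
  refine ⟨hs, fun K _ => ⟨h, by linarith, C, by linarith, fun x _ α => ?_⟩⟩
  refine le_trans ?_ (hb x (Set.mem_univ x) _)
  refine ((iteratedFDeriv ℝ _ f x).le_opNorm _).trans (le_of_eq ?_)
  simp

theorem iteratedFDeriv_eq_zero_of_notMem_tsupport {f : Rd d → ℂ} {x : Rd d} (hx : x ∉ tsupport f)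
    (n : ℕ) : iteratedFDeriv ℝ n f x = 0 :=
  image_eq_zero_of_notMem_tsupport fun h => hx (tsupport_iteratedFDeriv_subset n h)

theorem gevreyBound_univ (hσ : 1 < σ) {φ : TestFun d} (hφ : φ ∈ D d τ σ) :
    GevreyBound τ σ φ Set.univ := by
  obtain ⟨C, h, hC, hh, hb⟩ := gevreyBound_of_mem_E hσ hφ φ.hasCompactSupport
  refine ⟨C, h, hC, hh, fun x _ n => ?_⟩
  by_cases hx : x ∈ tsupport φ
  · exact hb x hx n
  · rw [iteratedFDeriv_eq_zero_of_notMem_tsupport hx, norm_zero]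
    have := M_pos (τ := τ) hσ n
    positivity

theorem norm_iteratedFDeriv_conj_comp (f : Rd d → ℂ) (n : ℕ) (x : Rd d) :
    ‖iteratedFDeriv ℝ n (fun t => conj (f t)) x‖ = ‖iteratedFDeriv ℝ n f x‖ :=
  Complex.conjLIE.norm_iteratedFDeriv_comp_left f x n

theorem norm_iteratedFDeriv_conjTranslate (g : TestFun d) (x : Rd d) (n : ℕ) (t : Rd d) :
    ‖iteratedFDeriv ℝ n (conjTranslate g x) t‖ = ‖iteratedFDeriv ℝ n g (t - x)‖ := by
  change ‖iteratedFDeriv ℝ n (fun t => conj (g (t - x))) t‖ = _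
  rw [norm_iteratedFDeriv_conj_comp (fun t => g (t - x)), iteratedFDeriv_comp_sub]

theorem conjTranslate_mem_D (hσ : 1 < σ) {g : TestFun d} (hg : g ∈ D d τ σ)
    (x : Rd d) : conjTranslate g x ∈ D d τ σ := by
  obtain ⟨C, h, hC, hh, hb⟩ := gevreyBound_univ hσ hg
  refine mem_E_of_gevreyBound (conjTranslate g x).contDiff ⟨C, h, hC, hh, fun t _ n => ?_⟩
  rw [norm_iteratedFDeriv_conjTranslate]
  exact hb _ (Set.mem_univ _) n

theorem tsupport_conjTranslate (g : TestFun d) (x : Rd d) :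
    tsupport (conjTranslate g x) = {t | t - x ∈ tsupport g} := by
  have h1 : Function.support (conjTranslate g x) =
      (Homeomorph.subRight x) ⁻¹' Function.support g := by
    ext t
    change conj (g (t - x)) ≠ 0 ↔ g (t - x) ≠ 0
    simp
  rw [tsupport, h1, ← (Homeomorph.subRight x).preimage_closure]
  rfl

/-- The test function `y ↦ φ (x₀ + c y)`. -/
def rescale (φ : TestFun d) (x₀ : Rd d) (c : ℝ) (hc : c ≠ 0) : TestFun d where
  toFun y := φ (x₀ + c • y)
  contDiff' := φ.contDiff.comp (contDiff_const.add (contDiff_id.const_smul c))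
  hasCompactSupport' := φ.hasCompactSupport.comp_homeomorph
    ((Homeomorph.smulOfNeZero c hc).trans (Homeomorph.addLeft x₀))
  tsupport_subset' := by simp

theorem tsupport_rescale (φ : TestFun d) (x₀ : Rd d) (c : ℝ) (hc : c ≠ 0) :
    tsupport (rescale φ x₀ c hc) = {y | x₀ + c • y ∈ tsupport φ} :=
  (((Homeomorph.smulOfNeZero c hc).trans (Homeomorph.addLeft x₀)).preimage_closure
    (Function.support φ)).symm

theorem rescale_mem_D (hσ : 1 < σ) {φ : TestFun d} (hφ : φ ∈ D d τ σ) (x₀ : Rd d)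
    {c : ℝ} (hc : 1 ≤ c) : rescale φ x₀ c (by positivity) ∈ D d τ σ := by
  obtain ⟨C, h, hC, hh, hb⟩ := gevreyBound_univ hσ hφ
  refine mem_E_of_gevreyBound (TestFunction.contDiff _)
    ⟨C, c * h, hC, one_le_mul_of_one_le_of_one_le hc hh, fun y _ n => ?_⟩
  have h1 : iteratedFDeriv ℝ n (fun z => φ (x₀ + c • z)) y =
      c ^ n • iteratedFDeriv ℝ n φ (x₀ + c • y) := by
    have hcd : ContDiff ℝ n (fun z => φ (x₀ + z)) :=
      (φ.contDiff.comp (contDiff_const.add contDiff_id)).of_le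
        (by exact_mod_cast (le_top : (n : ℕ∞) ≤ ⊤))
    have := congrFun (iteratedFDeriv_comp_const_smul c hcd) y
    rw [iteratedFDeriv_comp_add_left] at this
    exact this
  change ‖iteratedFDeriv ℝ n (fun z => φ (x₀ + c • z)) y‖ ≤ _
  rw [h1, norm_smul, Real.norm_of_nonneg (by positivity), Real.mul_rpow (by linarith) (by linarith)]
  calc c ^ n * ‖iteratedFDeriv ℝ n φ (x₀ + c • y)‖
      ≤ c ^ ((n : ℝ) ^ σ) * (C * h ^ ((n : ℝ) ^ σ) * M τ σ n) :=
        mul_le_mul (pow_le_rpow_rpow hσ hc n) (hb _ (Set.mem_univ _) n) (norm_nonneg _)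
          (by positivity)
    _ = _ := by ring

end GevreyBounds

/-! ### Applying a distribution under a Fourier integral. -/

section Superposition

open MeasureTheory FourierTransform

variable {d : ℕ}

/-- A linear functional bounded by `‖J ·‖` factors through a continuous functional. -/
theorem exists_clm_comp_eq {S X : Type*} [AddCommGroup S] [Module ℂ S] [NormedAddCommGroup X]
    [NormedSpace ℂ X] (J : S →ₗ[ℂ] X) (V : S →ₗ[ℂ] ℂ) {C : ℝ} (h : ∀ s, ‖V s‖ ≤ C * ‖J s‖) :
    ∃ v : X →L[ℂ] ℂ, ∀ s, v (J s) = V s := by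
  have hker : V ∈ J.ker.dualAnnihilator := by
    rw [Submodule.mem_dualAnnihilator]
    intro s hs
    have := h s
    rw [LinearMap.mem_ker.1 hs, norm_zero, mul_zero] at this
    exact norm_le_zero_iff.1 this
  rw [← LinearMap.range_dualMap_eq_dualAnnihilator_ker] at hker
  obtain ⟨g, hg⟩ := hker
  have hg' : ∀ s, g (J s) = V s := fun s => LinearMap.congr_fun hg s
  -- The algebraic factor `g` need not be continuous on X, but on the range of `J` it is bounded by
  -- `C`; Hahn–Banach extends it from there.
  let f : J.range →L[ℂ] ℂ := LinearMap.mkContinuous (g.domRestrict J.range) C (by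
    rintro ⟨_, s, rfl⟩
    change ‖g (J s)‖ ≤ C * ‖J s‖
    rw [hg']
    exact h s)
  obtain ⟨v, hv, -⟩ := exists_extension_norm_eq J.range f
  exact ⟨v, fun s => (hv ⟨J s, s, rfl⟩).trans (hg' s)⟩

/-- The complex vector space of smooth functions. -/
def smoothFun (d : ℕ) : Submodule ℂ (Rd d → ℂ) where
  carrier := {ψ | ContDiff ℝ ∞ ψ}
  add_mem' {f g} hf hg := by
    have hf : ContDiff ℝ ∞ f := hf
    exact hf.add hg
  zero_mem' := by
    have : ContDiff ℝ ∞ (fun _ : Rd d => (0 : ℂ)) := contDiff_const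
    exact this
  smul_mem' c f hf := by
    have hf : ContDiff ℝ ∞ f := hf
    exact hf.const_smul c

theorem contDiff_smoothFun (ψ : smoothFun d) : ContDiff ℝ ∞ (ψ : Rd d → ℂ) := ψ.2

theorem contDiffAt_smoothFun (ψ : smoothFun d) (k : ℕ) (x : Rd d) :
    ContDiffAt ℝ k (ψ : Rd d → ℂ) x :=
  ((contDiff_smoothFun ψ).of_le (by exact_mod_cast le_top)).contDiffAt

/-- The product of a smooth function and a test function. -/
def mulTest (φ : TestFun d) (ψ : smoothFun d) : TestFun d where
  toFun t := (ψ : Rd d → ℂ) t * φ t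
  contDiff' := ContDiff.mul ψ.2 φ.contDiff
  hasCompactSupport' := φ.hasCompactSupport.mul_left
  tsupport_subset' := by simp

/-- A distribution applied to products with a fixed test function. -/
def applyMulTest (φ : TestFun d) (u : Distr d) : smoothFun d →ₗ[ℂ] ℂ where
  toFun ψ := u (mulTest φ ψ)
  map_add' ψ₁ ψ₂ := by
    rw [← map_add]
    congr 1
    ext t
    exact add_mul _ _ _
  map_smul' c ψ := by
    rw [RingHom.id_apply, ← map_smul]
    congr 1
    ext t
    exact mul_assoc _ _ _

/-- Distributions have finite order on a compact set. -/
theorem exists_norm_applyMulTest_le (φ : TestFun d) (u : Distr d) :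
    ∃ (m : ℕ) (C : ℝ), 0 ≤ C ∧ ∀ (ψ : smoothFun d) (B : ℝ), 0 ≤ B →
      (∀ k ≤ m, ∀ t ∈ tsupport φ, ‖iteratedFDeriv ℝ k (ψ : Rd d → ℂ) t‖ ≤ B) →
      ‖applyMulTest φ u ψ‖ ≤ C * B := by
  let K : TopologicalSpace.Compacts (Rd d) := ⟨tsupport φ, φ.hasCompactSupport⟩
  have hK : (K : Set (Rd d)) ⊆ (⊤ : TopologicalSpace.Opens (Rd d)) := by simp
  -- On functions supported in the fixed compact set `K` the topology is given by countably many
  -- seminorms, and continuity of `u` involves finitely many of them; `m` is the highest order that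
  -- occurs.
  let v : 𝓓_{K}(Rd d, ℂ) →L[ℂ] ℂ := u.comp (TestFunction.ofSupportedInCLM ℂ hK)
  obtain ⟨s, C, -, hC⟩ := Seminorm.bound_of_continuous
    (ContDiffMapSupportedIn.withSeminorms ℂ (Rd d) ℂ ⊤ K)
    ((normSeminorm ℂ ℂ).comp v.toLinearMap) (continuous_norm.comp v.continuous)
  have hP : ∀ k : ℕ, ∃ P : ℝ, ∀ t, ‖iteratedFDeriv ℝ k φ t‖ ≤ P := fun k =>
    (φ.contDiff.continuous_iteratedFDeriv (by exact_mod_cast le_top)).bounded_above_of_compact_support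
      (φ.hasCompactSupport.iteratedFDeriv k)
  choose P hP using hP
  have hP0 : ∀ k, 0 ≤ P k := fun k => (norm_nonneg _).trans (hP k 0)
  set m := s.sup id with hm
  set Q := ∑ k ∈ Finset.range (m + 1), P k with hQ
  have hQ0 : 0 ≤ Q := Finset.sum_nonneg fun k _ => hP0 k
  refine ⟨m, C * (2 ^ m * Q), by positivity, fun ψ B hB hψ => ?_⟩
  let f : 𝓓_{K}(Rd d, ℂ) := ⟨mulTest φ ψ, (mulTest φ ψ).contDiff, fun t ht => by
    have : φ t = 0 := image_eq_zero_of_notMem_tsupport ht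
    change (ψ : Rd d → ℂ) t * φ t = 0
    rw [this, mul_zero]⟩
  have h1 : ‖applyMulTest φ u ψ‖ ≤ C * s.sup (ContDiffMapSupportedIn.seminorm ℂ (Rd d) ℂ ⊤ K) f :=
    hC f
  refine h1.trans ?_
  rw [mul_assoc]
  refine mul_le_mul_of_nonneg_left ?_ C.2
  refine Seminorm.finset_sup_apply_le (by positivity) fun i hi => ?_
  have him : i ≤ m := Finset.le_sup (f := id) hi
  refine (ContDiffMapSupportedIn.seminorm_top_le_iff ℂ (by positivity) i f).2 fun t ht => ?_
  refine (norm_iteratedFDeriv_mul_le (N := ∞) ψ.2 φ.contDiff t (by exact_mod_cast le_top)).trans ?_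
  have hterm : ∀ j ∈ Finset.range (i + 1), (i.choose j : ℝ) *
      ‖iteratedFDeriv ℝ j (ψ : Rd d → ℂ) t‖ * ‖iteratedFDeriv ℝ (i - j) φ t‖ ≤
      (i.choose j : ℝ) * (Q * B) := by
    intro j hj
    have hj : j ≤ i := Nat.lt_succ_iff.1 (Finset.mem_range.1 hj)
    have e : P (i - j) ≤ Q := Finset.single_le_sum (fun k _ => hP0 k)
      (Finset.mem_range.2 (by omega))
    rw [mul_assoc, mul_comm Q B]
    gcongr
    · exact hψ j (hj.trans him) t ht
    · exact (hP _ _).trans e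
  refine (Finset.sum_le_sum hterm).trans ?_
  rw [← Finset.sum_mul, ← Nat.cast_sum, Nat.sum_range_choose, mul_assoc]
  refine mul_le_mul_of_nonneg_right ?_ (by positivity)
  push_cast
  exact pow_le_pow_right₀ (by norm_num) him

/-- Continuous functions on `K` with values in the `k`-linear forms. -/
abbrev FormsOn (K : Set (Rd d)) (k : ℕ) : Type :=
  C(K, ContinuousMultilinearMap ℝ (fun _ : Fin k => Rd d) ℂ)

/-- Families of continuous functions on `K` with values in the `k`-linear forms, `k ≤ m`. -/
def JetSpace (K : Set (Rd d)) (m : ℕ) : Type := (k : Fin (m + 1)) → FormsOn K k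

set_option synthInstance.maxHeartbeats 400000 in
instance (K : Set (Rd d)) [CompactSpace K] (m : ℕ) : NormedAddCommGroup (JetSpace K m) :=
  inferInstanceAs (NormedAddCommGroup ((k : Fin (m + 1)) → FormsOn K k))

set_option synthInstance.maxHeartbeats 400000 in
instance (K : Set (Rd d)) [CompactSpace K] (m : ℕ) : NormedSpace ℂ (JetSpace K m) :=
  inferInstanceAs (NormedSpace ℂ ((k : Fin (m + 1)) → FormsOn K k))

set_option synthInstance.maxHeartbeats 400000 in
instance (K : Set (Rd d)) [CompactSpace K] (m : ℕ) : CompleteSpace (JetSpace K m) :=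
  inferInstanceAs (CompleteSpace ((k : Fin (m + 1)) → FormsOn K k))

/-- Evaluation of a jet at a point. -/
def evalJet {K : Set (Rd d)} [CompactSpace K] {m : ℕ} (k : Fin (m + 1)) (t : K) :
    JetSpace K m →L[ℂ] ContinuousMultilinearMap ℝ (fun _ : Fin k => Rd d) ℂ :=
  (ContinuousMap.evalCLM ℂ t).comp
    (ContinuousLinearMap.proj (R := ℂ) (φ := fun k : Fin (m + 1) => FormsOn K k) k)

theorem jetSpace_ext {K : Set (Rd d)} [CompactSpace K] {m : ℕ} {a b : JetSpace K m}
    (h : ∀ k t, evalJet k t a = evalJet k t b) : a = b :=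
  funext fun k => ContinuousMap.ext fun t => h k t

theorem norm_evalJet_le {K : Set (Rd d)} [CompactSpace K] {m : ℕ} (k : Fin (m + 1)) (t : K)
    (a : JetSpace K m) : ‖evalJet k t a‖ ≤ ‖a‖ :=
  ((a k).norm_coe_le_norm t).trans (norm_le_pi_norm (G := fun k : Fin (m + 1) => FormsOn K k) a k)

theorem norm_jetSpace_le {K : Set (Rd d)} [CompactSpace K] {m : ℕ} {a : JetSpace K m} {B : ℝ}
    (hB : 0 ≤ B) (h : ∀ k t, ‖evalJet k t a‖ ≤ B) : ‖a‖ ≤ B :=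
  (pi_norm_le_iff_of_nonneg (G := fun k : Fin (m + 1) => FormsOn K k) hB).2 fun k =>
    (ContinuousMap.norm_le _ hB).2 fun t => h k t

/-- The derivatives up to order `m`, restricted to a compact set. -/
def jet (K : Set (Rd d)) [CompactSpace K] (m : ℕ) : smoothFun d →ₗ[ℂ] JetSpace K m where
  toFun ψ k := ⟨fun t => iteratedFDeriv ℝ k (ψ : Rd d → ℂ) t,
    (ContDiff.continuous_iteratedFDeriv (by exact_mod_cast le_top) (contDiff_smoothFun ψ)).comp
      continuous_subtype_val⟩
  map_add' ψ₁ ψ₂ := jetSpace_ext fun k t =>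
    iteratedFDeriv_add_apply (contDiffAt_smoothFun ψ₁ k t) (contDiffAt_smoothFun ψ₂ k t)
  map_smul' c ψ := jetSpace_ext fun k t =>
    iteratedFDeriv_const_smul_apply (contDiffAt_smoothFun ψ k t)

theorem evalJet_jet {K : Set (Rd d)} [CompactSpace K] {m : ℕ} (k : Fin (m + 1)) (t : K)
    (ψ : smoothFun d) : evalJet k t (jet K m ψ) = iteratedFDeriv ℝ k (ψ : Rd d → ℂ) t :=
  rfl

/-- The character `t ↦ e^{-2πi t·η}`. -/
def char (η : Rd d) : smoothFun d :=
  ⟨fun t => Complex.exp (-(2 * Real.pi * Complex.I * (⟪t, η⟫ : ℝ))), by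
    change ContDiff ℝ ∞ fun t : Rd d => Complex.exp (-(2 * Real.pi * Complex.I * (⟪t, η⟫ : ℝ)))
    refine ContDiff.cexp (𝕜 := ℝ) (ContDiff.neg (contDiff_const.mul ?_))
    have h : ContDiff ℝ ∞ fun t : Rd d => ⟪t, η⟫ := contDiff_id.inner ℝ contDiff_const
    exact Complex.ofRealCLM.contDiff.comp h⟩

theorem char_apply (η t : Rd d) : (char η : Rd d → ℂ) t = Real.fourierChar (-⟪η, t⟫) := by
  rw [Real.fourierChar_apply, real_inner_comm]
  change Complex.exp _ = _
  congr 1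
  push_cast
  ring

/-- The character is the Fourier integral of the constant 1 against the Dirac mass at η, so the
derivative formula for Fourier integrals applies. -/
theorem iteratedFDeriv_char (k : ℕ) (η t : Rd d) :
    iteratedFDeriv ℝ k (char η : Rd d → ℂ) t = Real.fourierChar (-⟪η, t⟫) •
      VectorFourier.fourierPowSMulRight (innerSL ℝ) (fun _ : Rd d => (1 : ℂ)) η k := by
  have h := VectorFourier.iteratedFDeriv_fourierIntegral (N := ⊤) (innerSL ℝ)
    (μ := Measure.dirac η) (f := fun _ : Rd d => (1 : ℂ)) (n := k)
    (fun n _ => integrable_dirac (by simp)) aestronglyMeasurable_const (by exact_mod_cast le_top)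
  have h1 : VectorFourier.fourierIntegral Real.fourierChar (Measure.dirac η)
      (innerSL ℝ (E := Rd d)).toLinearMap₁₂ (fun _ : Rd d => (1 : ℂ)) = (char η : Rd d → ℂ) := by
    funext w
    simp [VectorFourier.fourierIntegral, char_apply, Circle.smul_def]
  rw [h1] at h
  rw [h]
  simp only [VectorFourier.fourierIntegral, integral_dirac]
  rfl

theorem norm_iteratedFDeriv_char_le (k : ℕ) (η t : Rd d) :
    ‖iteratedFDeriv ℝ k (char η : Rd d → ℂ) t‖ ≤ (2 * Real.pi) ^ k * ‖η‖ ^ k := by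
  rw [iteratedFDeriv_char, Circle.norm_smul]
  refine (VectorFourier.norm_fourierPowSMulRight_le _ _ _ _).trans ?_
  rw [norm_one, mul_one]
  have h : 2 * Real.pi * ‖innerSL ℝ (E := Rd d)‖ ≤ 2 * Real.pi :=
    mul_le_of_le_one_right (by positivity) (norm_innerSL_le ℝ)
  gcongr

theorem norm_iteratedFDeriv_char_le_of_le {k m : ℕ} (hk : k ≤ m) (η t : Rd d) :
    ‖iteratedFDeriv ℝ k (char η : Rd d → ℂ) t‖ ≤ (2 * Real.pi) ^ m * (1 + ‖η‖) ^ m := by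
  refine (norm_iteratedFDeriv_char_le k η t).trans ?_
  have h1 : (1 : ℝ) ≤ 2 * Real.pi := by linarith [Real.pi_gt_three]
  have h2 : (1 : ℝ) ≤ 1 + ‖η‖ := by linarith [norm_nonneg η]
  refine mul_le_mul (pow_le_pow_right₀ h1 hk) ?_ (by positivity) (by positivity)
  calc ‖η‖ ^ k ≤ (1 + ‖η‖) ^ k := by gcongr; linarith
    _ ≤ _ := pow_le_pow_right₀ h2 hk

theorem applyMulTest_char (φ : TestFun d) (u : Distr d) (η : Rd d) :
    applyMulTest φ u (char η) = fourierCutoff φ u η := rfl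

/-- Fourier transforms of compactly supported distributions have polynomial growth. -/
theorem exists_norm_fourierCutoff_le (φ : TestFun d) (u : Distr d) :
    ∃ (m : ℕ) (C : ℝ), 1 ≤ C ∧ ∀ η, ‖fourierCutoff φ u η‖ ≤ C * (1 + ‖η‖) ^ m := by
  obtain ⟨m, C, hC, h⟩ := exists_norm_applyMulTest_le φ u
  refine ⟨m, max 1 (C * (2 * Real.pi) ^ m), le_max_left _ _, fun η => ?_⟩
  refine (h (char η) _ (by positivity)
    fun k hk t _ => norm_iteratedFDeriv_char_le_of_le hk η t).trans ?_
  rw [← mul_assoc]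
  gcongr
  exact le_max_right _ _

/-- Joint continuity in (η, t) gives, by currying, continuity in η for the uniform norm; it makes
the Bochner integrand measurable. -/
theorem continuous_jet_char (K : Set (Rd d)) [CompactSpace K] (m : ℕ) :
    Continuous fun η : Rd d => jet K m (char η) := by
  refine continuous_pi (A := fun k : Fin (m + 1) => FormsOn K k) fun k => ?_
  have h : Continuous fun p : Rd d × K => iteratedFDeriv ℝ k (char p.1 : Rd d → ℂ) p.2 := by
    simp only [iteratedFDeriv_char]
    have h0 : Continuous fun _ : Rd d => (1 : ℂ) := continuous_const
    have h1 := h0.fourierPowSMulRight (L := innerSL ℝ (E := Rd d)) k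
    refine Continuous.smul ?_ (h1.comp continuous_fst)
    have h2 : Continuous fun p : Rd d × K => ⟪p.1, (p.2 : Rd d)⟫ :=
      continuous_fst.inner (continuous_subtype_val.comp continuous_snd)
    exact Continuous.subtype_val (Real.continuous_fourierChar.comp h2.neg)
  exact (ContinuousMap.curry ⟨_, h⟩).continuous

/-- A distribution applied to a superposition of characters. -/
theorem applyMulTest_fourier (φ : TestFun d) (u : Distr d) (f : SchwartzMap (Rd d) ℂ)
    (χ : smoothFun d) (hχ : (χ : Rd d → ℂ) = 𝓕 (f : Rd d → ℂ)) :
    applyMulTest φ u χ = ∫ η, f η * fourierCutoff φ u η := by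
  obtain ⟨m, C, hC, h⟩ := exists_norm_applyMulTest_le φ u
  set K := tsupport φ with hK
  have : CompactSpace K := isCompact_iff_compactSpace.1 φ.hasCompactSupport
  -- Having finite order, the functional factors through the Banach space of m-jets on `K`. There
  -- Bochner integrals exist and `v` commutes with them.
  obtain ⟨v, hv⟩ := exists_clm_comp_eq (jet K m) (applyMulTest φ u) (C := C) fun ψ =>
    h ψ _ (norm_nonneg (jet K m ψ)) fun k hk t ht =>
      norm_evalJet_le ⟨k, Nat.lt_succ_of_le hk⟩ ⟨t, ht⟩ (jet K m ψ)
  have hint : Integrable fun η => f η • jet K m (char η) := by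
    have hb : Integrable fun η => (2 * Real.pi) ^ m * ((1 + ‖η‖) ^ m * ‖f η‖) := by
      refine Integrable.const_mul ?_ _
      have he : (fun η : Rd d => (1 + ‖η‖) ^ m * ‖f η‖) = fun η =>
          ∑ i ∈ Finset.range (m + 1), (m.choose i : ℝ) * (‖η‖ ^ i * ‖f η‖) := by
        funext η
        rw [add_comm, add_pow, Finset.sum_mul]
        exact Finset.sum_congr rfl fun i _ => by ring
      rw [he]
      exact integrable_finsetSum _ fun i _ => (f.integrable_pow_mul volume i).const_mul _
    refine hb.mono' (f.continuous.smul (continuous_jet_char K m)).aestronglyMeasurable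
      (Filter.Eventually.of_forall fun η => ?_)
    rw [norm_smul]
    have : ‖jet K m (char η)‖ ≤ (2 * Real.pi) ^ m * (1 + ‖η‖) ^ m := by
      refine norm_jetSpace_le (by positivity) fun k t => ?_
      exact norm_iteratedFDeriv_char_le_of_le (Nat.lt_succ_iff.1 k.2) η t
    calc ‖f η‖ * ‖jet K m (char η)‖ ≤ ‖f η‖ * ((2 * Real.pi) ^ m * (1 + ‖η‖) ^ m) := by gcongr
      _ = _ := by ring
  -- Evaluating jets at points reduces this to differentiating the Fourier integral under the
  -- integral sign.
  have hjet : ∫ η, f η • jet K m (char η) = jet K m χ := by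
    refine jetSpace_ext fun k t => ?_
    rw [← (evalJet k t).integral_comp_comm hint, evalJet_jet, hχ, Real.iteratedFDeriv_fourier (N := ⊤)
      (fun n _ => f.integrable_pow_mul volume n) f.continuous.aestronglyMeasurable
      (by exact_mod_cast le_top), Real.fourier_eq]
    refine integral_congr_ae (Filter.Eventually.of_forall fun η => ?_)
    simp only [map_smul, evalJet_jet]
    rw [iteratedFDeriv_char]
    ext w
    simp [Circle.smul_def]
    ring
  rw [← hv, ← hjet, ← v.integral_comp_comm hint]
  refine integral_congr_ae (Filter.Eventually.of_forall fun η => ?_)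
  simp only [map_smul, hv, applyMulTest_char, smul_eq_mul]

end Superposition

/-! ### Local reciprocals and quotients in the class. -/

section Reciprocal

variable {d : ℕ} {τ σ : ℝ}

theorem norm_iteratedFDeriv_mul_le_of_isOpen {f g : Rd d → ℂ} {s : Set (Rd d)} (hs : IsOpen s)
    (hf : ContDiffOn ℝ ∞ f s) (hg : ContDiffOn ℝ ∞ g s) {x : Rd d} (hx : x ∈ s) (n : ℕ) :
    ‖iteratedFDeriv ℝ n (fun y => f y * g y) x‖ ≤ ∑ i ∈ Finset.range (n + 1),
      (n.choose i : ℝ) * ‖iteratedFDeriv ℝ i f x‖ * ‖iteratedFDeriv ℝ (n - i) g x‖ := by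
  have h := norm_iteratedFDerivWithin_mul_le hf hg hs.uniqueDiffOn hx (n := n)
    (by exact_mod_cast le_top)
  simpa only [iteratedFDerivWithin_of_isOpen _ hs hx] using h

/-- Products of functions with extended Gevrey bounds. -/
theorem sum_choose_mul_le (hτ : 0 < τ) (hσ : 1 < σ) {a b : ℕ → ℝ} {A B h : ℝ} (hh : 1 ≤ h)
    (hB : 0 ≤ B) (hb0 : ∀ n, 0 ≤ b n) (hA : 0 ≤ A)
    (ha : ∀ n, a n ≤ A * h ^ ((n : ℝ) ^ σ) * M τ σ n)
    (hb : ∀ n, b n ≤ B * h ^ ((n : ℝ) ^ σ) * M τ σ n) (n : ℕ) :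
    ∑ i ∈ Finset.range (n + 1), (n.choose i : ℝ) * a i * b (n - i) ≤
      A * B * (2 * h) ^ ((n : ℝ) ^ σ) * M τ σ n := by
  have hMn := M_pos (τ := τ) hσ n
  have hterm : ∀ i ∈ Finset.range (n + 1), (n.choose i : ℝ) * a i * b (n - i) ≤
      (n.choose i : ℝ) * (A * B * (h ^ ((n : ℝ) ^ σ) * M τ σ n)) := by
    intro i hi
    have hi : i ≤ n := Nat.lt_succ_iff.1 (Finset.mem_range.1 hi)
    have hMi := M_pos (τ := τ) hσ i
    have h1 := rpow_mul_M_mul_le (τ := τ) hτ hσ hh i (n - i)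
    rw [Nat.add_sub_cancel' hi] at h1
    rw [mul_assoc]
    refine mul_le_mul_of_nonneg_left ?_ (by positivity)
    calc a i * b (n - i)
        ≤ (A * h ^ ((i : ℝ) ^ σ) * M τ σ i) *
          (B * h ^ (((n - i : ℕ) : ℝ) ^ σ) * M τ σ (n - i)) :=
          mul_le_mul (ha i) (hb _) (hb0 _) (by positivity)
      _ = A * B * ((h ^ ((i : ℝ) ^ σ) * M τ σ i) *
          (h ^ (((n - i : ℕ) : ℝ) ^ σ) * M τ σ (n - i))) := by ring
      _ ≤ _ := mul_le_mul_of_nonneg_left h1 (by positivity)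
  refine (Finset.sum_le_sum hterm).trans ?_
  rw [← Finset.sum_mul, ← Nat.cast_sum, Nat.sum_range_choose,
    Real.mul_rpow (by norm_num) (by linarith)]
  push_cast
  calc (2 : ℝ) ^ n * (A * B * (h ^ ((n : ℝ) ^ σ) * M τ σ n))
      ≤ 2 ^ ((n : ℝ) ^ σ) * (A * B * (h ^ ((n : ℝ) ^ σ) * M τ σ n)) :=
        mul_le_mul_of_nonneg_right (pow_le_rpow_rpow hσ one_le_two n) (by positivity)
    _ = _ := by ring

/-- Local inverse-closedness of the extended Gevrey classes. -/
theorem exists_gevreyBound_inv (hτ : 0 < τ) (hσ : 1 < σ) {φ : TestFun d} (hφ : φ ∈ D d τ σ)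
    {x₀ : Rd d} (h0 : φ x₀ ≠ 0) : ∃ r > 0, (∀ t ∈ Metric.ball x₀ r, φ t ≠ 0) ∧
      GevreyBound τ σ (fun t => (φ t)⁻¹) (Metric.ball x₀ r) := by
  obtain ⟨C, h, hC, hh, hb⟩ := gevreyBound_univ hσ hφ
  set c := φ x₀ with hc
  have hc0 : 0 < ‖c‖ := norm_pos_iff.2 h0
  -- κ = 1 - φ/φ(x₀) vanishes at x₀, so it is at most 1/2 nearby, and θ = 1/φ solves the fixed-point
  -- equation θ = 1/φ(x₀) + κθ.
  let κ : Rd d → ℂ := fun t => 1 + -c⁻¹ * φ t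
  have hκs : ContDiff ℝ ∞ κ := contDiff_const.add (contDiff_const.mul φ.contDiff)
  have hκ0 : κ x₀ = 0 := by simp [κ, ← hc, h0]
  obtain ⟨r, hr, hball⟩ := Metric.continuousAt_iff.1 (hκs.continuous.continuousAt (x := x₀)) (1 / 2)
    (by norm_num)
  have hκ : ∀ t ∈ Metric.ball x₀ r, ‖κ t‖ ≤ 1 / 2 := by
    intro t ht
    have := hball ht
    rw [hκ0, dist_zero_right] at this
    exact this.le
  have hφlow : ∀ t ∈ Metric.ball x₀ r, ‖c‖ / 2 ≤ ‖φ t‖ := by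
    intro t ht
    have h1 : c - c * κ t = φ t := by simp only [κ]; field_simp; ring
    have h2 : ‖c‖ - ‖c * κ t‖ ≤ ‖φ t‖ := h1 ▸ norm_sub_norm_le _ _
    rw [norm_mul] at h2
    have := mul_le_mul_of_nonneg_left (hκ t ht) hc0.le
    linarith
  have hne : ∀ t ∈ Metric.ball x₀ r, φ t ≠ 0 := fun t ht =>
    norm_pos_iff.1 (lt_of_lt_of_le (by positivity) (hφlow t ht))
  have hB : (0 : ℝ) < 1 + ‖c‖⁻¹ * C := by positivity
  obtain ⟨H, hH, hrec⟩ := recursive_bound (τ := τ) hτ hσ hh hB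
  set θ : Rd d → ℂ := fun t => (φ t)⁻¹ with hθ
  have hθs : ContDiffOn ℝ ∞ θ (Metric.ball x₀ r) := φ.contDiff.contDiffOn.inv hne
  have hθκ : ∀ t ∈ Metric.ball x₀ r, θ t = c⁻¹ + κ t * θ t := by
    intro t ht
    have := hne t ht
    simp only [θ, κ]
    field_simp
    ring
  refine ⟨r, hr, hne, max 1 (2 / ‖c‖), H, le_max_left _ _, hH, fun t ht => ?_⟩
  have hbd : ∀ n, ‖iteratedFDeriv ℝ n κ t‖ ≤
      (1 + ‖c‖⁻¹ * C) * h ^ ((n : ℝ) ^ σ) * M τ σ n := by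
    intro n
    have hn : ((n : ℕ) : WithTop ℕ∞) ≤ ∞ := by exact_mod_cast le_top
    have hφn : ContDiffAt ℝ n φ t := (φ.contDiff.of_le hn).contDiffAt
    have e1 : iteratedFDeriv ℝ n κ t =
        iteratedFDeriv ℝ n (fun _ : Rd d => (1 : ℂ)) t + -c⁻¹ • iteratedFDeriv ℝ n φ t := by
      rw [← iteratedFDeriv_const_smul_apply hφn]
      exact iteratedFDeriv_add_apply contDiffAt_const (hφn.const_smul (-c⁻¹))
    have e2 : ‖iteratedFDeriv ℝ n (fun _ : Rd d => (1 : ℂ)) t‖ ≤ 1 := by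
      rcases eq_or_ne n 0 with rfl | hn0
      · simp
      · simp [iteratedFDeriv_const_of_ne hn0]
    have e3 : 1 ≤ h ^ ((n : ℝ) ^ σ) * M τ σ n :=
      one_le_mul_of_one_le_of_one_le (Real.one_le_rpow hh (natCast_rpow_nonneg n))
        (one_le_M hτ hσ n)
    rw [e1]
    refine (norm_add_le _ _).trans ?_
    rw [norm_smul, norm_neg, norm_inv]
    have := mul_le_mul_of_nonneg_left (hb t (Set.mem_univ _) n) (inv_nonneg.2 hc0.le)
    linarith
  refine hrec (fun n => ‖iteratedFDeriv ℝ n θ t‖) (fun n => ‖iteratedFDeriv ℝ n κ t‖) _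
    (fun n => norm_nonneg _) ?_ hbd ?_
  · rw [norm_iteratedFDeriv_zero, norm_inv]
    refine le_trans ?_ (le_max_right _ _)
    rw [← inv_div]
    exact inv_anti₀ (by positivity) (hφlow t ht)
  · intro n hn
    have hn' : ((n : ℕ) : WithTop ℕ∞) ≤ ∞ := by exact_mod_cast le_top
    have hnhds := Metric.isOpen_ball.mem_nhds ht
    have e1 : iteratedFDeriv ℝ n θ t = iteratedFDeriv ℝ n (fun y => κ y * θ y) t := by
      have h1 : Set.EqOn θ ((fun _ => c⁻¹) + fun y => κ y * θ y) (Metric.ball x₀ r) := hθκ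
      rw [← iteratedFDerivWithin_of_isOpen n Metric.isOpen_ball ht, iteratedFDerivWithin_congr h1 ht,
        iteratedFDerivWithin_of_isOpen n Metric.isOpen_ball ht, iteratedFDeriv_add_apply contDiffAt_const
        (hκs.contDiffAt.of_le hn' |>.mul ((hθs.contDiffAt hnhds).of_le hn')),
        iteratedFDeriv_const_of_ne (by omega)]
      simp
    have e2 := norm_iteratedFDeriv_mul_le_of_isOpen Metric.isOpen_ball hκs.contDiffOn hθs ht n
    -- The split-off term i = 0 is ‖κ‖ times the n-th derivative of θ itself; the bound 1/2 on κ
    -- lets the recursion absorb it on the left.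
    rw [← e1, Finset.sum_range_succ'] at e2
    simp only [Nat.choose_zero_right, Nat.cast_one, one_mul, norm_iteratedFDeriv_zero,
      Nat.sub_zero] at e2
    refine e2.trans ?_
    rw [add_comm]
    gcongr
    exact hκ t ht

/-- The quotients `conj (g (· - x)) / φ` for `x` near `x₀`. -/
theorem exists_quotient (hτ : 0 < τ) (hσ : 1 < σ) {φ g : TestFun d} (hg : g ∈ D d τ σ)
    {x₀ : Rd d} {r ρ : ℝ} (hρr : 2 * ρ < r) (hne : ∀ t ∈ Metric.ball x₀ r, φ t ≠ 0)
    (hinv : GevreyBound τ σ (fun t => (φ t)⁻¹) (Metric.ball x₀ r))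
    (hgs : tsupport g ⊆ Metric.closedBall 0 ρ) :
    ∃ C H : ℝ, 1 ≤ C ∧ 1 ≤ H ∧ ∀ x ∈ Metric.closedBall x₀ ρ, ∃ χ : TestFun d,
      (∀ t, χ t * φ t = conj (g (t - x))) ∧ tsupport χ ⊆ Metric.closedBall x₀ (2 * ρ) ∧
      ∀ n t, ‖iteratedFDeriv ℝ n χ t‖ ≤ C * H ^ ((n : ℝ) ^ σ) * M τ σ n := by
  obtain ⟨C₁, h₁, hC₁, hh₁, hb₁⟩ := hinv
  obtain ⟨C₂, h₂, hC₂, hh₂, hb₂⟩ := gevreyBound_univ hσ hg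
  have hh : 1 ≤ max h₁ h₂ := hh₁.trans (le_max_left _ _)
  -- The constants do not depend on `x`, since translation and conjugation preserve the derivative
  -- bounds of `g`.
  refine ⟨C₂ * C₁, 2 * max h₁ h₂, one_le_mul_of_one_le_of_one_le hC₂ hC₁,
    one_le_mul_of_one_le_of_one_le one_le_two hh, fun x hx => ?_⟩
  have hsupp : tsupport (conjTranslate g x) ⊆ Metric.closedBall x₀ (2 * ρ) := by
    rw [tsupport_conjTranslate]
    intro t ht
    have h1 := hgs ht
    rw [mem_closedBall_zero_iff] at h1
    rw [Metric.mem_closedBall, dist_eq_norm] at hx ⊢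
    calc ‖t - x₀‖ = ‖(t - x) + (x - x₀)‖ := by congr 1; abel
      _ ≤ ‖t - x‖ + ‖x - x₀‖ := norm_add_le _ _
      _ ≤ 2 * ρ := by linarith
  have hcb : Metric.closedBall x₀ (2 * ρ) ⊆ Metric.ball x₀ r := Metric.closedBall_subset_ball hρr
  have hts : tsupport (fun t => conjTranslate g x t * (φ t)⁻¹) ⊆ tsupport (conjTranslate g x) :=
    closure_mono (Function.support_mul_subset_left _ _)
  -- On the support of the translated window φ does not vanish; off it the product is locally zero,
  -- however φ⁻¹ behaves there.
  have hsm : ContDiff ℝ ∞ fun t => conjTranslate g x t * (φ t)⁻¹ := by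
    refine contDiff_iff_contDiffAt.2 fun t => ?_
    by_cases ht : t ∈ tsupport (conjTranslate g x)
    · exact (conjTranslate g x).contDiff.contDiffAt.mul
        (φ.contDiff.contDiffAt.inv (hne t (hcb (hsupp ht))))
    · have h1 : (fun t => conjTranslate g x t * (φ t)⁻¹) =ᶠ[𝓝 t] fun _ => 0 :=
        notMem_tsupport_iff_eventuallyEq.1 fun h => ht (hts h)
      exact contDiffAt_const.congr_of_eventuallyEq h1
  refine ⟨⟨fun t => conjTranslate g x t * (φ t)⁻¹, hsm,
    (conjTranslate g x).hasCompactSupport.mul_right, by simp⟩, fun t => ?_, hts.trans hsupp,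
    fun n t => ?_⟩
  · change conj (g (t - x)) * (φ t)⁻¹ * φ t = conj (g (t - x))
    by_cases ht : t ∈ tsupport (conjTranslate g x)
    · rw [mul_assoc, inv_mul_cancel₀ (hne t (hcb (hsupp ht))), mul_one]
    · have : conjTranslate g x t = 0 := image_eq_zero_of_notMem_tsupport ht
      change conj (g (t - x)) = 0 at this
      rw [this]; simp
  · change ‖iteratedFDeriv ℝ n (fun t => conjTranslate g x t * (φ t)⁻¹) t‖ ≤ _
    have hMn := M_pos (τ := τ) hσ n
    by_cases ht : t ∈ tsupport (conjTranslate g x)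
    · have htb := hcb (hsupp ht)
      have hw : ∀ (C h : ℝ), 1 ≤ C → 1 ≤ h → h ≤ max h₁ h₂ → ∀ k : ℕ,
          C * h ^ ((k : ℝ) ^ σ) * M τ σ k ≤ C * max h₁ h₂ ^ ((k : ℝ) ^ σ) * M τ σ k := by
        intro C h hC hh' hle k
        have hMk := M_pos (τ := τ) hσ k
        have := rpow_rpow_mono hσ hh' hle (le_refl k)
        gcongr
      refine (norm_iteratedFDeriv_mul_le_of_isOpen Metric.isOpen_ball
        (conjTranslate g x).contDiff.contDiffOn (φ.contDiff.contDiffOn.inv hne) htb n).trans ?_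
      refine sum_choose_mul_le hτ hσ hh (by linarith) (fun _ => norm_nonneg _) (by linarith)
        (a := fun k => ‖iteratedFDeriv ℝ k (conjTranslate g x) t‖)
        (b := fun k => ‖iteratedFDeriv ℝ k (fun t => (φ t)⁻¹) t‖)
        (fun k => ?_) (fun k => ?_) n
      · rw [norm_iteratedFDeriv_conjTranslate]
        exact (hb₂ _ (Set.mem_univ _) k).trans (hw _ _ hC₂ hh₂ (le_max_right _ _) k)
      · exact (hb₁ t htb k).trans (hw _ _ hC₁ hh₁ (le_max_left _ _) k)
    · rw [iteratedFDeriv_eq_zero_of_notMem_tsupport fun h => ht (hts h), norm_zero]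
      positivity

end Reciprocal

/-! ### Decay of Fourier transforms of class functions, with uniform constants. -/

section FourierDecay

open MeasureTheory FourierTransform

variable {d : ℕ} {τ σ : ℝ}

/-- Fourier transforms of functions with extended Gevrey bounds and support in a fixed ball. -/
theorem exists_pow_mul_norm_fourier_le (hτ : 0 < τ) (hσ : 1 < σ) (x₀ : Rd d) (R : ℝ) {C H : ℝ}
    (hC : 1 ≤ C) (hH : 1 ≤ H) :
    ∃ C' H' : ℝ, 1 ≤ C' ∧ 1 ≤ H' ∧ ∀ χ : TestFun d, tsupport χ ⊆ Metric.closedBall x₀ R →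
      (∀ n t, ‖iteratedFDeriv ℝ n χ t‖ ≤ C * H ^ ((n : ℝ) ^ σ) * M τ σ n) →
      ∀ (n : ℕ) (η : Rd d), ‖η‖ ^ n * ‖𝓕 (χ : Rd d → ℂ) η‖ ≤
        C' * H' ^ ((n : ℝ) ^ σ) * M τ σ n := by
  set v : ℝ := (volume (Metric.closedBall x₀ R)).toReal with hv
  have hv0 : 0 ≤ v := ENNReal.toReal_nonneg
  -- The factor 4^n combines the 2^n of the general Fourier estimate with the bound n + 1 ≤ 2^n on
  -- the number of integrals.
  refine ⟨C * (1 + v), 4 * H, one_le_mul_of_one_le_of_one_le hC (by linarith), by linarith,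
    fun χ hs hχ n η => ?_⟩
  have hMn := M_pos (τ := τ) hσ n
  have hbound : ∀ p ≤ n, ∫ t, ‖iteratedFDeriv ℝ p χ t‖ ≤ C * H ^ ((n : ℝ) ^ σ) * M τ σ n * v := by
    intro p hp
    have e1 : ∫ t, ‖iteratedFDeriv ℝ p χ t‖ =
        ∫ t in Metric.closedBall x₀ R, ‖iteratedFDeriv ℝ p χ t‖ := by
      refine (setIntegral_eq_integral_of_forall_compl_eq_zero fun t ht => ?_).symm
      rw [iteratedFDeriv_eq_zero_of_notMem_tsupport fun h => ht (hs h), norm_zero]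
    have e2 : ∀ t ∈ Metric.closedBall x₀ R, ‖‖iteratedFDeriv ℝ p χ t‖‖ ≤
        C * H ^ ((n : ℝ) ^ σ) * M τ σ n := by
      intro t _
      rw [norm_norm]
      refine (hχ p t).trans ?_
      have h1 := rpow_rpow_mono hσ hH le_rfl hp
      have h2 := M_mono (τ := τ) hτ hσ hp
      have h3 := M_pos (τ := τ) hσ p
      gcongr
    rw [e1]
    exact (le_abs_self _).trans
      (norm_setIntegral_le_of_norm_le_const measure_closedBall_lt_top e2)
  have h := Real.pow_mul_norm_iteratedFDeriv_fourier_le (f := (χ : Rd d → ℂ)) (K := 0) (N := ⊤)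
    χ.contDiff (fun k p hk _ => by
      obtain rfl : k = 0 := by exact_mod_cast nonpos_iff_eq_zero.1 hk
      simp only [pow_zero, one_mul]
      exact ((χ.contDiff.continuous_iteratedFDeriv
        (by exact_mod_cast le_top)).integrable_of_hasCompactSupport
        (χ.hasCompactSupport.iteratedFDeriv p)).norm)
    (k := 0) (n := n) le_rfl le_top η
  simp only [norm_iteratedFDeriv_zero, pow_zero, one_mul, Nat.cast_zero, mul_zero, zero_add,
    Finset.range_one, Finset.sum_product, Finset.sum_singleton] at h
  refine h.trans ?_
  have hsum : ∑ p ∈ Finset.range (n + 1), ∫ t, ‖iteratedFDeriv ℝ p χ t‖ ≤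
      2 ^ n * (C * H ^ ((n : ℝ) ^ σ) * M τ σ n * v) := by
    refine (Finset.sum_le_sum fun p hp =>
      hbound p (Nat.lt_succ_iff.1 (Finset.mem_range.1 hp))).trans ?_
    rw [Finset.sum_const, Finset.card_range, nsmul_eq_mul]
    refine mul_le_mul_of_nonneg_right ?_ (by positivity)
    exact_mod_cast Nat.lt_two_pow_self
  calc (2 : ℝ) ^ n * ∑ p ∈ Finset.range (n + 1), ∫ t, ‖iteratedFDeriv ℝ p χ t‖
      ≤ 2 ^ n * (2 ^ n * (C * H ^ ((n : ℝ) ^ σ) * M τ σ n * v)) := by gcongr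
    _ = 4 ^ n * (C * H ^ ((n : ℝ) ^ σ) * M τ σ n * v) := by
        rw [← mul_assoc, ← mul_pow]; norm_num
    _ ≤ 4 ^ ((n : ℝ) ^ σ) * (C * H ^ ((n : ℝ) ^ σ) * M τ σ n * (1 + v)) := by
        refine mul_le_mul (pow_le_rpow_rpow hσ (by norm_num) n) ?_ (by positivity) (by positivity)
        refine mul_le_mul_of_nonneg_left (by linarith) (by positivity)
    _ = C * (1 + v) * (4 * H) ^ ((n : ℝ) ^ σ) * M τ σ n := by
        rw [Real.mul_rpow (by norm_num) (by linarith)]; ring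

/-- A weight of degree L costs L further powers of y, and the sequence tolerates a shift by L. It
will pay for the polynomial growth of the transform of φu and for integrability in η. -/
theorem exists_one_add_pow_mul_le (hτ : 0 < τ) (hσ : 1 < σ) {C H : ℝ} (hC : 1 ≤ C) (hH : 1 ≤ H)
    (L : ℕ) : ∃ C' H' : ℝ, 1 ≤ C' ∧ 1 ≤ H' ∧ ∀ (y F : ℝ), 0 ≤ y → 0 ≤ F →
      (∀ n : ℕ, y ^ n * F ≤ C * H ^ ((n : ℝ) ^ σ) * M τ σ n) →
      ∀ n : ℕ, (1 + y) ^ L * (y ^ n * F) ≤ C' * H' ^ ((n : ℝ) ^ σ) * M τ σ n := by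
  obtain ⟨A, H', hA, hH', hsh⟩ := rpow_mul_M_shift_le (τ := τ) hτ hσ hH L
  refine ⟨2 ^ L * (C + C * A), max H H', ?_, hH.trans (le_max_left _ _),
    fun y F hy hF hyp n => ?_⟩
  · refine one_le_mul_of_one_le_of_one_le (one_le_pow₀ one_le_two) ?_
    nlinarith
  have hMn := M_pos (τ := τ) hσ n
  have h1 : (1 + y) ^ L ≤ 2 ^ L * (1 + y ^ L) := by
    rcases le_total y 1 with hy1 | hy1
    · calc (1 + y) ^ L ≤ 2 ^ L := pow_le_pow_left₀ (by positivity) (by linarith) L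
        _ ≤ _ := le_mul_of_one_le_right (by positivity) (by linarith [pow_nonneg hy L])
    · calc (1 + y) ^ L ≤ (2 * y) ^ L := pow_le_pow_left₀ (by positivity) (by linarith) L
        _ = 2 ^ L * y ^ L := mul_pow _ _ _
        _ ≤ _ := by gcongr; linarith
  have h2 : y ^ n * F ≤ C * max H H' ^ ((n : ℝ) ^ σ) * M τ σ n := by
    refine (hyp n).trans ?_
    have := rpow_rpow_mono hσ hH (le_max_left H H') (le_refl n)
    gcongr
  have h3 : y ^ (n + L) * F ≤ C * A * max H H' ^ ((n : ℝ) ^ σ) * M τ σ n := by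
    refine (hyp (n + L)).trans ?_
    have e := rpow_rpow_mono hσ hH' (le_max_right H H') (le_refl n)
    calc C * H ^ (((n + L : ℕ) : ℝ) ^ σ) * M τ σ (n + L)
        = C * (H ^ (((n + L : ℕ) : ℝ) ^ σ) * M τ σ (n + L)) := by ring
      _ ≤ C * (A * H' ^ ((n : ℝ) ^ σ) * M τ σ n) := mul_le_mul_of_nonneg_left (hsh n) (by linarith)
      _ ≤ C * (A * max H H' ^ ((n : ℝ) ^ σ) * M τ σ n) := by gcongr
      _ = _ := by ring
  calc (1 + y) ^ L * (y ^ n * F) ≤ 2 ^ L * (1 + y ^ L) * (y ^ n * F) := by gcongr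
    _ = 2 ^ L * (y ^ n * F + y ^ (n + L) * F) := by rw [pow_add]; ring
    _ ≤ 2 ^ L * (C * max H H' ^ ((n : ℝ) ^ σ) * M τ σ n +
        C * A * max H H' ^ ((n : ℝ) ^ σ) * M τ σ n) := by gcongr
    _ = _ := by ring

end FourierDecay

/-! ### Passing between e^{-T} and the family of bounds indexed by N. -/

section AssociatedFunction

variable {τ σ : ℝ}

/-- T dominates the logarithm of its N-th term. Boundedness matters here, as a real supremum over an
unbounded set would be 0. -/
theorem exp_neg_T_le (hτ : 0 < τ) (hσ : 1 < σ) {k s : ℝ} (hk : 0 < k) (hs : 0 < s) {N : ℕ}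
    (hN : 1 ≤ N) :
    Real.exp (-T τ σ k s) ≤ k⁻¹ ^ ((N : ℝ) ^ σ) * M τ σ N / s ^ N := by
  have hMN := M_pos (τ := τ) hσ N
  have h1 := le_ciSup (bddAbove_T hτ hσ hk hs) ⟨N, hN⟩
  have h2 : Real.log (k ^ ((N : ℝ) ^ σ) * s ^ N / M τ σ N) ≤ T τ σ k s :=
    (le_max_right _ _).trans h1
  rw [Real.log_le_iff_le_exp (by positivity)] at h2
  rw [Real.exp_neg]
  refine (inv_anti₀ (by positivity) h2).trans (le_of_eq ?_)
  rw [Real.inv_rpow hk.le]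
  field_simp

/-- Each estimate bounds one term of T by log (C/V). The case N = 0 gives V ≤ C, hence log (C/V) ≥
0, as the truncation in ln₊ requires. -/
theorem le_mul_exp_neg_T (hσ : 1 < σ) {H s C V : ℝ} (hH : 0 < H) (hs : 0 < s)
    (hC : 0 < C) (hV : 0 ≤ V) (h : ∀ N : ℕ, V ≤ C * (H ^ ((N : ℝ) ^ σ) * M τ σ N / s ^ N)) :
    V ≤ C * Real.exp (-T τ σ H⁻¹ s) := by
  rcases hV.eq_or_lt with rfl | hV
  · positivity
  have hVC : V ≤ C := by
    simpa [M_zero hσ, Real.zero_rpow (by linarith : σ ≠ 0)] using h 0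
  have hT : T τ σ H⁻¹ s ≤ Real.log (C / V) := by
    refine ciSup_le fun p => max_le (Real.log_nonneg ((one_le_div hV).2 hVC)) ?_
    have hMp := M_pos (τ := τ) hσ p
    refine Real.log_le_log (by positivity) ?_
    rw [le_div_iff₀ hV]
    refine (mul_le_mul_of_nonneg_left (h p) (by positivity)).trans (le_of_eq ?_)
    rw [Real.inv_rpow hH.le]
    field_simp
  have h1 : Real.exp (-Real.log (C / V)) ≤ Real.exp (-T τ σ H⁻¹ s) :=
    Real.exp_le_exp.2 (neg_le_neg hT)
  rw [Real.exp_neg, Real.exp_log (by positivity), inv_div, div_le_iff₀ hC] at h1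
  linarith

end AssociatedFunction

/-! ### Cones, the convolution formula and the splitting of the integral. -/

section Microlocal

open MeasureTheory FourierTransform

variable {d : ℕ} {τ σ : ℝ}

/-- Conic neighbourhoods can be shrunk so as to be stable under small relative perturbations. -/
theorem IsConicNhd.exists_shrink {Γ : Set (Rd d)} {ξ₀ : Rd d} (hΓ : IsConicNhd Γ ξ₀)
    (hξ₀ : ξ₀ ≠ 0) : ∃ (Γ₀ : Set (Rd d)) (c : ℝ), IsConicNhd Γ₀ ξ₀ ∧ 0 < c ∧ c ≤ 1 / 2 ∧
      ∀ ξ ∈ Γ₀, ∀ η : Rd d, ‖η‖ ≤ c * ‖ξ‖ → ξ + η ∈ Γ := by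
  obtain ⟨hn, h0, hcone⟩ := hΓ
  obtain ⟨ε, hε, hball⟩ := Metric.mem_nhds_iff.1 hn
  have hpos : 0 < ‖ξ₀‖ := norm_pos_iff.2 hξ₀
  -- Half of ε is reserved for the perturbation η; δ ≤ ‖ξ₀‖ keeps 0 out of the new cone and gives
  -- t‖ξ‖ ≤ 2‖ξ₀‖, whence the choice of ε / (4‖ξ₀‖).
  set δ := min (ε / 2) ‖ξ₀‖ with hδ
  have hδ0 : 0 < δ := lt_min (by positivity) hpos
  have hc : 0 < min (1 / 2) (ε / (4 * ‖ξ₀‖)) := lt_min (by norm_num) (by positivity)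
  refine ⟨{ξ | ∃ t : ℝ, 0 < t ∧ t • ξ ∈ Metric.ball ξ₀ δ}, min (1 / 2) (ε / (4 * ‖ξ₀‖)),
    ⟨?_, ?_, ?_⟩, hc, min_le_left _ _, ?_⟩
  · filter_upwards [Metric.ball_mem_nhds ξ₀ hδ0] with ξ hξ
    exact ⟨1, one_pos, by simpa using hξ⟩
  · rintro ⟨t, -, ht⟩
    rw [smul_zero, Metric.mem_ball, dist_eq_norm, zero_sub, norm_neg] at ht
    exact absurd ht (not_lt.2 (min_le_right _ _))
  · rintro ξ ⟨t, ht, hξ⟩ s hs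
    refine ⟨t / s, by positivity, ?_⟩
    rwa [smul_smul, div_mul_cancel₀ _ hs.ne']
  · rintro ξ ⟨t, ht, hξ⟩ η hη
    rw [Metric.mem_ball, dist_eq_norm] at hξ
    have h1 : t * ‖ξ‖ ≤ 2 * ‖ξ₀‖ := by
      have e : ‖t • ξ‖ ≤ ‖t • ξ - ξ₀‖ + ‖ξ₀‖ := by
        simpa using norm_add_le (t • ξ - ξ₀) ξ₀
      rw [norm_smul, Real.norm_of_nonneg ht.le] at e
      linarith [min_le_right (ε / 2) ‖ξ₀‖]
    have h2 : t * ‖η‖ ≤ ε / 2 := by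
      calc t * ‖η‖ ≤ t * (min (1 / 2) (ε / (4 * ‖ξ₀‖)) * ‖ξ‖) := by gcongr
        _ = min (1 / 2) (ε / (4 * ‖ξ₀‖)) * (t * ‖ξ‖) := by ring
        _ ≤ ε / (4 * ‖ξ₀‖) * (2 * ‖ξ₀‖) := by
            gcongr
            exact min_le_right _ _
        _ = ε / 2 := by field_simp; norm_num
    have h3 : t • (ξ + η) ∈ Γ := by
      refine hball ?_
      rw [Metric.mem_ball, dist_eq_norm]
      calc ‖t • (ξ + η) - ξ₀‖ = ‖(t • ξ - ξ₀) + t • η‖ := by congr 1; rw [smul_add]; abel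
        _ ≤ ‖t • ξ - ξ₀‖ + t * ‖η‖ := by
            refine (norm_add_le _ _).trans (le_of_eq ?_)
            rw [norm_smul, Real.norm_of_nonneg ht.le]
        _ < ε := by linarith [min_le_left (ε / 2) ‖ξ₀‖]
    have h4 := hcone _ h3 t⁻¹ (inv_pos.2 ht)
    rwa [smul_smul, inv_mul_cancel₀ ht.ne', one_smul] at h4

/-- The Fourier transform of `χ φ u` is the convolution of those of `χ` and of `φ u`. -/
theorem apply_modulate_eq_integral (u : Distr d) {φ χ ψ : TestFun d} (h : ∀ t, χ t * φ t = ψ t)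
    (ξ : Rd d) : u (modulate ψ ξ) =
      ∫ η, 𝓕⁻ (χ : Rd d → ℂ) η * fourierCutoff φ u (ξ + η) := by
  let S : SchwartzMap (Rd d) ℂ := χ.hasCompactSupport.toSchwartzMap χ.contDiff
  -- Fourier inversion on Schwartz functions writes χ as a superposition of characters; modulating φ
  -- by ξ then shifts the frequency η to ξ + η.
  have hS : (χ : Rd d → ℂ) = 𝓕 ((𝓕⁻ S : SchwartzMap (Rd d) ℂ) : Rd d → ℂ) := by
    rw [← SchwartzMap.fourier_coe, FourierTransform.fourier_fourierInv_eq]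
    rfl
  have h1 := applyMulTest_fourier (modulate φ ξ) u (𝓕⁻ S) ⟨χ, χ.contDiff⟩ hS
  have h2 : applyMulTest (modulate φ ξ) u ⟨χ, χ.contDiff⟩ = u (modulate ψ ξ) := by
    change u (mulTest _ _) = _
    congr 1
    ext t
    change χ t * (Complex.exp _ * φ t) = Complex.exp _ * ψ t
    rw [← h]
    ring
  have h3 : ∀ η, fourierCutoff (modulate φ ξ) u η = fourierCutoff φ u (ξ + η) := by
    intro η
    unfold fourierCutoff
    congr 1
    ext t
    change Complex.exp _ * (Complex.exp _ * φ t) = Complex.exp _ * φ t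
    rw [← mul_assoc, ← Complex.exp_add]
    congr 2
    rw [inner_add_right]
    push_cast
    ring
  rw [← h2, h1]
  refine integral_congr_ae (Filter.Eventually.of_forall fun η => ?_)
  simp only [h3, SchwartzMap.fourierInv_coe]
  rfl

/-- Stability of the decay in a cone under multiplication by functions of the class. -/
theorem exists_norm_apply_modulate_le (hτ : 0 < τ) (hσ : 1 < σ) (u : Distr d) (φ : TestFun d)
    {Γ Γ₀ : Set (Rd d)} {c h C₁ : ℝ} (hc : 0 < c) (hc2 : c ≤ 1 / 2) (h0 : (0 : Rd d) ∉ Γ₀)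
    (h0' : (0 : Rd d) ∉ Γ)
    (hΓ₀ : ∀ ξ ∈ Γ₀, ∀ η : Rd d, ‖η‖ ≤ c * ‖ξ‖ → ξ + η ∈ Γ) (hh : 0 < h) (hC₁ : 0 < C₁)
    (hu : ∀ N : ℕ, 1 ≤ N → ∀ ξ ∈ Γ,
      ‖fourierCutoff φ u ξ‖ ≤ C₁ * (h ^ ((N : ℝ) ^ σ) * M τ σ N / ‖ξ‖ ^ N))
    (x₀ : Rd d) (R : ℝ) {C₂ H₂ : ℝ} (hC₂ : 1 ≤ C₂) (hH₂ : 1 ≤ H₂) :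
    ∃ C H : ℝ, 0 < C ∧ 0 < H ∧ ∀ χ ψ : TestFun d, (∀ t, χ t * φ t = ψ t) →
      tsupport χ ⊆ Metric.closedBall x₀ R →
      (∀ n t, ‖iteratedFDeriv ℝ n χ t‖ ≤ C₂ * H₂ ^ ((n : ℝ) ^ σ) * M τ σ n) →
      ∀ ξ ∈ Γ₀, ∀ N : ℕ,
        ‖u (modulate ψ ξ)‖ ≤ C * (H ^ ((N : ℝ) ^ σ) * M τ σ N / ‖ξ‖ ^ N) := by
  obtain ⟨m, P, hP, hpoly⟩ := exists_norm_fourierCutoff_le φ u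
  set h₁ := max h 1 with hh₁
  have h₁1 : 1 ≤ h₁ := le_max_right _ _
  -- This constant extends the decay to N = 0: the polynomial bound covers ‖ξ‖ ≤ 1, and the case N =
  -- 1 covers ‖ξ‖ ≥ 1.
  set A := P * 2 ^ m + C₁ * h₁ with hA
  have hA0 : 0 < A := by positivity
  have hu' : ∀ N : ℕ, ∀ ξ ∈ Γ,
      ‖fourierCutoff φ u ξ‖ ≤ A * (h₁ ^ ((N : ℝ) ^ σ) * M τ σ N / ‖ξ‖ ^ N) := by
    intro N ξ hξ
    rcases Nat.eq_zero_or_pos N with rfl | hN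
    · simp only [Nat.cast_zero, Real.zero_rpow (by linarith : σ ≠ 0), Real.rpow_zero,
        M_zero hσ, pow_zero, div_one, mul_one]
      rcases le_total ‖ξ‖ 1 with h1 | h1
      · have : (1 + ‖ξ‖) ^ m ≤ 2 ^ m := pow_le_pow_left₀ (by positivity) (by linarith) m
        have h2 := mul_le_mul_of_nonneg_left this (by linarith : 0 ≤ P)
        have h3 : 0 ≤ C₁ * h₁ := by positivity
        linarith [hpoly ξ]
      · have h2 := hu 1 le_rfl ξ hξ
        have h3 : C₁ * (h / ‖ξ‖) ≤ C₁ * h₁ := by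
          refine mul_le_mul_of_nonneg_left ?_ hC₁.le
          exact (div_le_self hh.le h1).trans (le_max_left _ _)
        have h4 : 0 ≤ P * 2 ^ m := by positivity
        simp only [M, Nat.cast_one, Real.one_rpow, Real.rpow_one, mul_one, pow_one] at h2
        linarith
    · refine (hu N hN ξ hξ).trans ?_
      have hMN := M_pos (τ := τ) hσ N
      have e1 : C₁ ≤ A := by
        have : C₁ ≤ C₁ * h₁ := le_mul_of_one_le_right hC₁.le h₁1
        have h4 : 0 ≤ P * 2 ^ m := by positivity
        linarith
      have e2 : h ^ ((N : ℝ) ^ σ) ≤ h₁ ^ ((N : ℝ) ^ σ) :=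
        Real.rpow_le_rpow hh.le (le_max_left _ _) (natCast_rpow_nonneg N)
      gcongr
  obtain ⟨C₃, H₃, hC₃, hH₃, hdecay⟩ := exists_pow_mul_norm_fourier_le (τ := τ) hτ hσ x₀ R hC₂ hH₂
  obtain ⟨C₄, H₄, hC₄, hH₄, hshift⟩ :=
    exists_one_add_pow_mul_le (τ := τ) hτ hσ hC₃ hH₃ (m + (d + 1))
  set Q := P * (1 + c⁻¹) ^ m with hQ
  have hQ0 : 0 < Q := by positivity
  -- The first entry serves ‖η‖ ≤ c‖ξ‖, where ‖ξ + η‖ ≥ ‖ξ‖/2; the second serves ‖η‖ > c‖ξ‖, where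
  -- ‖η‖^{-N} ≤ (c‖ξ‖)^{-N}.
  set H := max (2 * h₁) (c⁻¹ * H₄) with hH
  have hH0 : 0 < H := lt_of_lt_of_le (by positivity) (le_max_left _ _)
  let J : Rd d → ℝ := fun η => ((1 + ‖η‖) ^ (d + 1))⁻¹
  have hJint : Integrable J := by
    have h1 := integrable_one_add_norm (E := Rd d) (μ := volume) (r := ((d + 1 : ℕ) : ℝ))
      (by simp)
    refine h1.congr (Filter.Eventually.of_forall fun η => ?_)
    simp only [J]
    rw [Real.rpow_neg (by positivity), Real.rpow_natCast]
  have hJ0 : 0 ≤ ∫ η, J η := integral_nonneg fun η => by positivity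
  have hc1 : 1 ≤ c⁻¹ := (one_le_inv₀ hc).2 (by linarith)
  refine ⟨(A * C₄ + Q * C₄) * (1 + ∫ η, J η), H, by positivity, hH0,
    fun χ ψ hψ hs hχ ξ hξ N => ?_⟩
  have hMN := M_pos (τ := τ) hσ N
  have hξ0 : 0 < ‖ξ‖ := norm_pos_iff.2 fun h => h0 (h ▸ hξ)
  set W := H ^ ((N : ℝ) ^ σ) * M τ σ N / ‖ξ‖ ^ N with hW
  have hW0 : 0 < W := by positivity
  have hpt : ∀ η, ‖𝓕⁻ (χ : Rd d → ℂ) η * fourierCutoff φ u (ξ + η)‖ ≤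
      (A * C₄ + Q * C₄) * W * J η := by
    intro η
    rw [norm_mul]
    set y := ‖η‖ with hy
    set F := ‖𝓕⁻ (χ : Rd d → ℂ) η‖ with hF
    have hy0 : 0 ≤ y := norm_nonneg _
    have hF0 : 0 ≤ F := norm_nonneg _
    have hFy : ∀ n : ℕ, (1 + y) ^ (m + (d + 1)) * (y ^ n * F) ≤
        C₄ * H₄ ^ ((n : ℝ) ^ σ) * M τ σ n := by
      refine hshift y F hy0 hF0 fun n => ?_
      have := hdecay χ hs hχ n (-η)
      rwa [norm_neg, ← Real.fourierInv_eq_fourier_neg] at this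
    have hJη : 0 < J η := by positivity
    have hone : (1 : ℝ) ≤ 1 + y := by linarith
    rcases le_or_gt y (c * ‖ξ‖) with hcase | hcase
    · have e1 : F ≤ C₄ * J η := by
        have h1 := hFy 0
        simp only [Nat.cast_zero, Real.zero_rpow (by linarith : σ ≠ 0), Real.rpow_zero,
          M_zero hσ, pow_zero, mul_one, one_mul] at h1
        have h2 : (1 + y) ^ (d + 1) * F ≤ C₄ :=
          le_trans (mul_le_mul_of_nonneg_right (pow_le_pow_right₀ hone (by omega)) hF0) h1
        change F ≤ C₄ * ((1 + y) ^ (d + 1))⁻¹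
        rw [← div_eq_mul_inv, le_div_iff₀ (by positivity)]
        linarith
      have hmem := hΓ₀ ξ hξ η hcase
      have hζ0 : 0 < ‖ξ + η‖ := norm_pos_iff.2 fun h => h0' (h ▸ hmem)
      have hζ : ‖ξ‖ / 2 ≤ ‖ξ + η‖ := by
        have h1 : ‖ξ‖ ≤ ‖ξ + η‖ + ‖η‖ := by simpa using norm_sub_le (ξ + η) η
        have h2 := mul_le_mul_of_nonneg_right hc2 hξ0.le
        linarith
      have e2 : ‖fourierCutoff φ u (ξ + η)‖ ≤ A * W := by
        refine (hu' N _ hmem).trans (mul_le_mul_of_nonneg_left ?_ hA0.le)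
        calc h₁ ^ ((N : ℝ) ^ σ) * M τ σ N / ‖ξ + η‖ ^ N
            ≤ h₁ ^ ((N : ℝ) ^ σ) * M τ σ N / (‖ξ‖ / 2) ^ N := by gcongr
          _ = 2 ^ N * h₁ ^ ((N : ℝ) ^ σ) * M τ σ N / ‖ξ‖ ^ N := by
              rw [div_pow]; field_simp
          _ ≤ W := by
              refine div_le_div_of_nonneg_right ?_ (by positivity)
              refine mul_le_mul_of_nonneg_right ?_ hMN.le
              calc (2 : ℝ) ^ N * h₁ ^ ((N : ℝ) ^ σ)
                  ≤ 2 ^ ((N : ℝ) ^ σ) * h₁ ^ ((N : ℝ) ^ σ) := by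
                    gcongr
                    exact pow_le_rpow_rpow hσ one_le_two N
                _ = (2 * h₁) ^ ((N : ℝ) ^ σ) := by
                    rw [Real.mul_rpow (by norm_num) (by linarith)]
                _ ≤ _ := Real.rpow_le_rpow (by positivity) (le_max_left _ _)
                    (natCast_rpow_nonneg N)
      calc F * ‖fourierCutoff φ u (ξ + η)‖ ≤ C₄ * J η * (A * W) := by gcongr
        _ = A * C₄ * W * J η := by ring
        _ ≤ _ := by
          gcongr
          linarith [mul_pos hQ0 (by linarith : 0 < C₄)]
    · have hypos : 0 < y := lt_of_le_of_lt (by positivity) hcase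
      have e1 : ‖fourierCutoff φ u (ξ + η)‖ ≤ Q * (1 + y) ^ m := by
        refine (hpoly _).trans ?_
        rw [hQ, mul_assoc, ← mul_pow]
        have h1 : ‖ξ‖ ≤ c⁻¹ * y := by
          rw [inv_mul_eq_div, le_div_iff₀ hc]; linarith
        -- Far from the cone's centre ξ is controlled by η, so polynomial growth in ξ + η becomes
        -- growth in η, which the decay of χ pays for.
        have h2 : 1 + ‖ξ + η‖ ≤ (1 + c⁻¹) * (1 + y) := by
          have := norm_add_le ξ η
          nlinarith
        gcongr
      have e2 : (1 + y) ^ m * F ≤ C₄ * W * J η := by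
        have h1 := hFy N
        have h2 : (1 + y) ^ m * F = (1 + y) ^ (m + (d + 1)) * (y ^ N * F) / y ^ N * J η := by
          simp only [J, ← hy]
          rw [pow_add]
          field_simp
        rw [h2]
        refine mul_le_mul_of_nonneg_right ?_ hJη.le
        calc (1 + y) ^ (m + (d + 1)) * (y ^ N * F) / y ^ N
            ≤ C₄ * H₄ ^ ((N : ℝ) ^ σ) * M τ σ N / (c * ‖ξ‖) ^ N := by gcongr
          _ = C₄ * ((c⁻¹ ^ N * H₄ ^ ((N : ℝ) ^ σ)) * M τ σ N / ‖ξ‖ ^ N) := by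
              rw [mul_pow, inv_pow]; field_simp
          _ ≤ C₄ * W := by
              refine mul_le_mul_of_nonneg_left ?_ (by linarith)
              refine div_le_div_of_nonneg_right ?_ (by positivity)
              refine mul_le_mul_of_nonneg_right ?_ hMN.le
              calc c⁻¹ ^ N * H₄ ^ ((N : ℝ) ^ σ)
                  ≤ c⁻¹ ^ ((N : ℝ) ^ σ) * H₄ ^ ((N : ℝ) ^ σ) := by
                    gcongr
                    exact pow_le_rpow_rpow hσ hc1 N
                _ = (c⁻¹ * H₄) ^ ((N : ℝ) ^ σ) := by
                    rw [Real.mul_rpow (by positivity) (by linarith)]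
                _ ≤ _ := Real.rpow_le_rpow (by positivity) (le_max_right _ _)
                    (natCast_rpow_nonneg N)
      calc F * ‖fourierCutoff φ u (ξ + η)‖ ≤ F * (Q * (1 + y) ^ m) := by gcongr
        _ = Q * ((1 + y) ^ m * F) := by ring
        _ ≤ Q * (C₄ * W * J η) := by gcongr
        _ = Q * C₄ * W * J η := by ring
        _ ≤ _ := by
          gcongr
          linarith [mul_pos hA0 (by linarith : 0 < C₄)]
  rw [apply_modulate_eq_integral u hψ ξ]
  refine (norm_integral_le_of_norm_le (hJint.const_mul _)
    (Filter.Eventually.of_forall hpt)).trans ?_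
  rw [integral_const_mul]
  have : 0 ≤ (A * C₄ + Q * C₄) * W := by positivity
  linarith

end Microlocal

end ExtGevrey

end

/-! ### The equivalence. -/

theorem theorem4p5 (d : ℕ) (τ σ : ℝ) (hτ : 0 < τ) (hσ : 1 < σ) (u : ExtGevrey.Distr d)
    (x₀ ξ₀ : ExtGevrey.Rd d) (hξ₀ : ξ₀ ≠ 0) :
    (x₀, ξ₀) ∉ ExtGevrey.WF τ σ u ↔
      ∃ Γ₀ : Set (ExtGevrey.Rd d), ExtGevrey.IsConicNhd Γ₀ ξ₀ ∧
      ∃ K : Set (ExtGevrey.Rd d), IsCompact K ∧ K ∈ 𝓝 x₀ ∧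
      ∃ g ∈ ExtGevrey.D d τ σ, tsupport g = {y | y + x₀ ∈ K} ∧ g 0 ≠ 0 ∧
      ∃ k > 0, ∃ C > 0, ∀ x ∈ K, ∀ ξ ∈ Γ₀,
        ‖ExtGevrey.stft g u x ξ‖ ≤ C * Real.exp (-ExtGevrey.T τ σ k ‖ξ‖) := by
  open ExtGevrey in
  constructor
  · intro hWF
    simp only [WF, Set.mem_ofPred_eq, not_and, not_not] at hWF
    obtain ⟨Γ, hΓ, -, -, φ, hφ, -, hφ0, h, hh, C₁, hC₁, hu⟩ := hWF hξ₀
    obtain ⟨Γ₀, c, hΓ₀, hc, hc2, hsub⟩ := hΓ.exists_shrink hξ₀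
    obtain ⟨r, hr, hne, hinv⟩ := exists_gevreyBound_inv hτ hσ hφ hφ0
    obtain ⟨R, hR⟩ := φ.hasCompactSupport.isBounded.subset_closedBall x₀
    set ρ := r / 3 with hρ
    have hρ0 : 0 < ρ := by positivity
    -- Compressing φ about x₀ by this factor puts the window's support in the ball of radius ρ; a
    -- translate by x with ‖x - x₀‖ ≤ ρ then stays within 2ρ < r, where φ ≠ 0.
    set a := max 1 (R / ρ) with ha
    have ha1 : 1 ≤ a := le_max_left _ _
    have ha0 : a ≠ 0 := by positivity
    set g := rescale φ x₀ a ha0 with hgdef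
    have hg : g ∈ D d τ σ := rescale_mem_D hσ hφ x₀ ha1
    have hgs : tsupport g = {y | x₀ + a • y ∈ tsupport φ} := tsupport_rescale φ x₀ a ha0
    have hgρ : tsupport g ⊆ Metric.closedBall 0 ρ := by
      intro y hy
      rw [hgs] at hy
      have h1 := hR hy
      rw [Metric.mem_closedBall, dist_eq_norm, add_sub_cancel_left, norm_smul,
        Real.norm_of_nonneg (by linarith)] at h1
      rw [mem_closedBall_zero_iff]
      have h2 : R ≤ a * ρ := (div_le_iff₀ hρ0).1 (le_max_right _ _)
      exact le_of_mul_le_mul_left (h1.trans h2) (by linarith)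
    have hg0 : g 0 ≠ 0 := by
      change φ (x₀ + a • 0) ≠ 0
      simpa using hφ0
    obtain ⟨C₂, H₂, hC₂, hH₂, hquot⟩ :=
      exists_quotient hτ hσ hg (ρ := ρ) (by linarith) hne hinv hgρ
    obtain ⟨C, H, hC, hH, hest⟩ := exists_norm_apply_modulate_le hτ hσ u φ hc hc2 hΓ₀.2.1 hΓ.2.1
      hsub hh hC₁ hu x₀ (2 * ρ) hC₂ hH₂
    refine ⟨Γ₀, hΓ₀, {x | x - x₀ ∈ tsupport g}, ?_, ?_, g, hg, by simp, hg0, H⁻¹, inv_pos.2 hH,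
      C, hC, fun x hx ξ hξ => ?_⟩
    · exact (Homeomorph.subRight x₀).isClosedEmbedding.isCompact_preimage g.hasCompactSupport
    · have h1 : tsupport g ∈ 𝓝 (x₀ - x₀) := by
        rw [sub_self]
        exact Filter.mem_of_superset (g.continuous.isOpen_support.mem_nhds hg0) subset_closure
      exact (continuous_id.sub continuous_const).continuousAt h1
    · have hxb : x ∈ Metric.closedBall x₀ ρ := by
        have := hgρ hx
        rwa [mem_closedBall_zero_iff, ← dist_eq_norm] at this
      obtain ⟨χ, hχ1, hχ2, hχ3⟩ := hquot x hxb
      have hξ0 : 0 < ‖ξ‖ := norm_pos_iff.2 fun h => hΓ₀.2.1 (h ▸ hξ)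
      exact le_mul_exp_neg_T hσ hH hξ0 hC (norm_nonneg _) fun N =>
        hest χ (conjTranslate g x) hχ1 hχ2 hχ3 ξ hξ N
  · rintro ⟨Γ₀, hΓ₀, K, hK, hKx, g, hg, hgK, hg0, k, hk, C, hC, hest⟩
    rintro ⟨-, hWF⟩
    -- The same `K` works because translating the window by x₀ turns its support into exactly `K`.
    refine hWF ⟨Γ₀, hΓ₀, K, hK, conjTranslate g x₀, conjTranslate_mem_D hσ hg x₀, ?_, ?_,
      k⁻¹, inv_pos.2 hk, C, hC, fun N hN ξ hξ => ?_⟩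
    · rw [tsupport_conjTranslate, hgK]
      ext t
      simp
    · change conj (g (x₀ - x₀)) ≠ 0
      simpa using hg0
    · have hξ0 : 0 < ‖ξ‖ := norm_pos_iff.2 fun h => hΓ₀.2.1 (h ▸ hξ)
      refine (hest x₀ (mem_of_mem_nhds hKx) ξ hξ).trans ?_
      exact mul_le_mul_of_nonneg_left (exp_neg_T_le hτ hσ hk hξ0 hN) hC.le
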